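/- Let $\mathfrak A$ be a C*-algebra with unit, $\Phi:\mathfrak A\to\mathfrak A$ a unital completely positive map (ucp-map), and $\varphi$ a state on $\mathfrak A$ with $\varphi\circ\Phi=\varphi$. Suppose that $\Phi$ admits a $\varphi$-adjoint, i.e. there is a ucp-map $\Phi_\natural:\mathfrak A\to\mathfrak A$ with $\varphi(\Phi(a)b)=\varphi(a\Phi_\natural(b))$ for all $a,b\in\mathfrak A$. The state $\varphi$ is called ergodic if $\frac1{N+1}\sum_{k=0}^N[\varphi(a\Phi^k(b))-\varphi(a)\varphi(b)]\to0$ for all $a,b\in\mathfrak A$, and weakly mixing if $\frac1{N+1}\sum_{k=0}^N|\varphi(a\Phi^k(b))-\varphi(a)\varphi(b)|\to0$ for all $a,b\in\mathfrak A$. Let $(\pi,\mathcal H,\mathbf V)$ be any covariant representation of $\Phi$: $\pi$ is a faithful unital representation of $\mathfrak A$ on a Hilbert space $\mathcal H$ and $\mathbf V$ is an isometry on $\mathcal H$ with $\mathbf V^*\pi(a)\mathbf V=\pi(\Phi(a))$ for all $a\in\mathfrak A$. (The direct sum of the iterated Stinespring spaces of $\Phi$ is one.) Identify $\mathfrak A$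 with $\pi(\mathfrak A)\subset\mathcal B(\mathcal H)$. Put $\mathbf F=\mathbf I-\mathbf V\mathbf V^*$, $\widehat{\mathcal H}=\mathcal H\oplus l^2(\mathbf F\mathcal H)$, $\mathbf Z\psi=\psi\oplus0$, $\Pi_j(\xi_0,\xi_1,\dots)=\xi_j$, $\mathbf W(\xi_0,\xi_1,\dots)=(\xi_1,\xi_2,\dots)$, and let $\widehat{\mathbf V}=\begin{pmatrix}\mathbf V&\mathbf F\Pi_0\\0&\mathbf W\end{pmatrix}$ be the minimal unitary dilation of $\mathbf V$. For a string $\alpha=(n_1,\dots,n_r,A_1,\dots,A_r)$, $n_i\in\mathbb N$, $A_i\in\mathfrak A$, put $\dot\alpha=\sum_i n_i$, $|\alpha)=A_1\mathbf V^{n_1}\cdots A_r\mathbf V^{n_r}$, $(\alpha|=\mathbf V^{n_r*}A_r\cdots\mathbf V^{n_1*}A_1$. The gamma operators are $\Gamma(\alpha)=(\alpha|\mathbf F\Pi_{\dot\alpha-1}$ for $\dot\alpha\ge1$, and $\mathfrak X$ is the norm closed linear span of the operators $\Pi_{\dot\alpha+k}^*\mathbf F|\alpha)A(\beta|\mathbf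 F\Pi_{\dot\beta+k}$ with strings $\alpha,\beta$, $A\in\mathfrak A$, $k\in\mathbb N$. Let $C^*(\mathcal S)$ be the unital C*-algebra generated by the set $\mathcal S$ of all operators $\begin{pmatrix}A&\Gamma_1\\\Gamma_2^*&T\end{pmatrix}$ on $\widehat{\mathcal H}$ with $A\in\mathfrak A$, $T\in\mathfrak X$ and gamma operators $\Gamma_1,\Gamma_2$, and let the dilation algebra $\widehat{\mathfrak A}$ be the smallest unital C*-subalgebra of $C^*(\mathcal S)$ that contains $\mathbf Z\mathfrak A\mathbf Z^*$ and satisfies $\widehat{\mathbf V}^*\widehat{\mathfrak A}\widehat{\mathbf V}\subset\widehat{\mathfrak A}$. Then for all $X,Y\in\widehat{\mathfrak A}$ and $k\in\mathbb N$ the operators $\mathbf Z^*X\mathbf Z$, $\mathbf Z^*Y\mathbf Z$ and $\mathbf Z^*X\widehat{\mathbf V}^{k*}Y\widehat{\mathbf V}^k\mathbf Z$ belong to $\mathfrak A$, and if $\varphi$ is ergodic, $$\lim_{N\to\infty}\frac1{N+1}\sum_{k=0}^N\bigl[\varphi(\mathbf Z^*X\widehat{\mathbf V}^{k*}Y\widehat{\mathbf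 V}^k\mathbf Z)-\varphi(\mathbf Z^*X\mathbf Z)\,\varphi(\mathbf Z^*Y\mathbf Z)\bigr]=0,$$ while if $\varphi$ is weakly mixing, $$\lim_{N\to\infty}\frac1{N+1}\sum_{k=0}^N\bigl|\varphi(\mathbf Z^*X\widehat{\mathbf V}^{k*}Y\widehat{\mathbf V}^k\mathbf Z)-\varphi(\mathbf Z^*X\mathbf Z)\,\varphi(\mathbf Z^*Y\mathbf Z)\bigr|=0.$$ -/

import Mathlib

open scoped ComplexOrder CStarAlgebra InnerProductSpace Topology ENNReal
open Filter

noncomputable section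

/-! ### Ergodic notions for a ucp-map and an invariant state -/

section Ergodic

variable {A : Type*} [CStarAlgebra A] [PartialOrder A] [StarOrderedRing A]

/-- The state `φ` is ergodic for `Φ`: the Cesàro means of `φ(a Φᵏ(b)) - φ(a) φ(b)` tend to `0`. -/
def IsErgodicState (Φ : A →CP A) (φ : A →ₚ[ℂ] ℂ) : Prop :=
  ∀ a b : A, Tendsto (fun N : ℕ => (1 / ((N : ℂ) + 1)) *
    ∑ k ∈ Finset.range (N + 1), (φ (a * (⇑Φ)^[k] b) - φ a * φ b)) atTop (𝓝 0)

/-- The state `φ` is weakly mixing for `Φ`: the Cesàro means of `|φ(a Φᵏ(b)) - φ(a) φ(b)|`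
tend to `0`. -/
def IsWeaklyMixingState (Φ : A →CP A) (φ : A →ₚ[ℂ] ℂ) : Prop :=
  ∀ a b : A, Tendsto (fun N : ℕ => (1 / ((N : ℝ) + 1)) *
    ∑ k ∈ Finset.range (N + 1), ‖φ (a * (⇑Φ)^[k] b) - φ a * φ b‖) atTop (𝓝 0)

/-- `Φ` admits a `φ`-adjoint: a unital completely positive map `Ψ` on the same algebra with
`φ(Φ(a) b) = φ(a Ψ(b))`. -/
def AdmitsAdjoint (Φ : A →CP A) (φ : A →ₚ[ℂ] ℂ) : Prop :=
  ∃ Ψ : A →CP A, Ψ 1 = 1 ∧ ∀ a b : A, φ (Φ a * b) = φ (a * Ψ b)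

end Ergodic

/-! ### The minimal unitary dilation of an isometry -/

namespace Nagy

variable {H : Type*} [NormedAddCommGroup H] [InnerProductSpace ℂ H] [CompleteSpace H]
variable (V : H →ₗᵢ[ℂ] H)

/-- The isometry as a bounded operator. -/
abbrev op : H →L[ℂ] H := V.toContinuousLinearMap

/-- The projection `F = I - V V*`. -/
def F : H →L[ℂ] H := 1 - op V * star (op V)

/-- The subspace `F H`. -/
def defect : Submodule ℂ H := LinearMap.range (F V).toLinearMap

lemma star_op_mul_op : star (op V) * op V = 1 := by
  refine ContinuousLinearMap.ext fun x => ext_inner_left ℂ fun y => ?_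
  simp [ContinuousLinearMap.star_eq_adjoint, ContinuousLinearMap.adjoint_inner_right]

lemma F_mul_F : F V * F V = F V := by
  have h := star_op_mul_op V
  simp only [F, sub_mul, mul_sub, one_mul, mul_one]
  rw [mul_assoc, ← mul_assoc (star (op V)) (op V), h, one_mul, sub_self, sub_zero]

lemma mem_defect_iff (x : H) : x ∈ defect V ↔ F V x = x := by
  constructor
  · rintro ⟨y, rfl⟩
    exact congrArg (fun T : H →L[ℂ] H => T y) (F_mul_F V)
  · intro h
    exact ⟨x, h⟩

lemma isClosed_defect : IsClosed ((defect V : Submodule ℂ H) : Set H) := by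
  have : ((defect V : Submodule ℂ H) : Set H) = {x | F V x = x} := by
    ext x; exact mem_defect_iff V x
  rw [this]
  exact isClosed_eq (F V).continuous continuous_id

/-- The Hilbert space `F H`, as a type. -/
def FH : Type _ := defect V

instance : NormedAddCommGroup (FH V) := inferInstanceAs (NormedAddCommGroup (defect V))
instance : InnerProductSpace ℂ (FH V) := inferInstanceAs (InnerProductSpace ℂ (defect V))
instance : CompleteSpace (FH V) := (isClosed_defect V).completeSpace_coe

/-- The inclusion of `F H` into `H`. -/
def incl : FH V →L[ℂ] H := (defect V).subtypeL

/-- The Hilbert space `l²(F H)`. -/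
abbrev L2 : Type _ := lp (fun _ : ℕ => FH V) 2

/-- The canonical projection `Π_j : l²(F H) → H`, `ξ ↦ ξ_j`. -/
def proj (j : ℕ) : L2 V →L[ℂ] H :=
  incl V ∘L lp.evalCLM ℂ (fun _ : ℕ => FH V) 2 j

/-- The left shift `W (ξ₀, ξ₁, …) = (ξ₁, ξ₂, …)` on `l²(F H)`. -/
def W : L2 V →L[ℂ] L2 V :=
  LinearMap.mkContinuous
    { toFun := fun ξ => ⟨fun n => ξ (n + 1), by
        have h := (memℓp_gen_iff (by norm_num)).1 (lp.memℓp ξ)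
        exact memℓp_gen ((summable_nat_add_iff 1).2 h)⟩
      map_add' := fun _ _ => rfl
      map_smul' := fun _ _ => rfl } 1 (fun ξ => by
    have h := (memℓp_gen_iff (p := 2) (by norm_num)).1 (lp.memℓp ξ)
    rw [one_mul]
    refine lp.norm_le_of_tsum_le (by norm_num) (norm_nonneg _) ?_
    rw [lp.norm_rpow_eq_tsum (by norm_num) ξ, h.tsum_eq_zero_add]
    exact le_add_of_nonneg_left (by positivity))

@[simp] lemma W_apply (ξ : L2 V) (n : ℕ) : W V ξ n = ξ (n + 1) := rfl

/-- The Hilbert space `Ĥ = H ⊕ l²(F H)`. -/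
abbrev Hhat : Type _ := WithLp 2 (H × L2 V)

/-- The operator on `H ⊕ l²(F H)` with the operator matrix `(a b; c d)`. -/
def block (a : H →L[ℂ] H) (b : L2 V →L[ℂ] H) (c : H →L[ℂ] L2 V) (d : L2 V →L[ℂ] L2 V) :
    Hhat V →L[ℂ] Hhat V :=
  (WithLp.prodContinuousLinearEquiv 2 ℂ H (L2 V)).symm.toContinuousLinearMap ∘L
    ((a.coprod b).prod (c.coprod d)) ∘L
    (WithLp.prodContinuousLinearEquiv 2 ℂ H (L2 V)).toContinuousLinearMap

/-- The unitary dilation `V̂ = (V FΠ₀; 0 W)`. -/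
def Vhat : Hhat V →L[ℂ] Hhat V := block V (op V) (F V ∘L proj V 0) 0 (W V)

/-- The isometric embedding `Z : H → Ĥ`, `x ↦ x ⊕ 0`. -/
def Z : H →L[ℂ] Hhat V :=
  (WithLp.prodContinuousLinearEquiv 2 ℂ H (L2 V)).symm.toContinuousLinearMap ∘L
    ContinuousLinearMap.inl ℂ H (L2 V)

/-- The compression `Z* X Z` of an operator on `Ĥ` to `H`. -/
def compress (X : Hhat V →L[ℂ] Hhat V) : H →L[ℂ] H :=
  (Z V).adjoint ∘L X ∘L Z V

/-! ### The dilation algebra -/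

variable (𝔄 : StarSubalgebra ℂ (H →L[ℂ] H))

/-- A string `(n₁, …, n_r, A₁, …, A_r)` of the algebra, as the list of the pairs `(n_i, A_i)`.
The empty list behaves as the string `(0, I)`. -/
abbrev Str : Type _ := List (ℕ × 𝔄)

variable {𝔄}

/-- The weight `n₁ + ⋯ + n_r` of a string. -/
def weight (α : Str 𝔄) : ℕ := (α.map Prod.fst).sum

/-- `|α) = A₁ V^{n₁} ⋯ A_r V^{n_r}`. -/
def ket : Str 𝔄 → (H →L[ℂ] H)
  | [] => 1
  | (n, a) :: α => (a : H →L[ℂ] H) * op V ^ n * ket α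

/-- `(α| = V^{n_r *} A_r ⋯ V^{n₁ *} A₁`. -/
def bra : Str 𝔄 → (H →L[ℂ] H)
  | [] => 1
  | (n, a) :: α => bra α * (star (op V) ^ n * (a : H →L[ℂ] H))

/-- The gamma operator `Γ(α) = (α| F Π_{|α|-1} : l²(F H) → H`
(used for strings of weight at least one). -/
def Gam (α : Str 𝔄) : L2 V →L[ℂ] H := bra V α ∘L F V ∘L proj V (weight α - 1)

/-- The napla operator `Δ_k(A, α, β) = Π*_{|α|+k} F |α) A (β| F Π_{|β|+k}` on `l²(F H)`. -/
def Nap (k : ℕ) (a : 𝔄) (α β : Str 𝔄) : L2 V →L[ℂ] L2 V :=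
  (proj V (weight α + k)).adjoint ∘L
    (F V * ket V α * (a : H →L[ℂ] H) * bra V β * F V) ∘L proj V (weight β + k)

variable (𝔄)

/-- The norm closure `𝔛` of the linear span of the napla operators. -/
def napAlg : Submodule ℂ (L2 V →L[ℂ] L2 V) :=
  (Submodule.span ℂ {T | ∃ (k : ℕ) (a : 𝔄) (α β : Str 𝔄), T = Nap V k a α β}).topologicalClosure

/-- The set `𝒮` of the operator matrices `(A Γ₁; Γ₂* T)` with `A ∈ 𝔄`, `T ∈ 𝔛`, and `Γ₁`, `Γ₂`
gamma operators. -/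
def opSystem : Set (Hhat V →L[ℂ] Hhat V) :=
  {X | ∃ (a : 𝔄) (α β : Str 𝔄) (T : L2 V →L[ℂ] L2 V), 1 ≤ weight α ∧ 1 ≤ weight β ∧
    T ∈ napAlg V 𝔄 ∧ X = block V (a : H →L[ℂ] H) (Gam V α) (Gam V β).adjoint T}

/-- The unital C*-algebra `C*(𝒮)` generated by `𝒮`. -/
def opSystemAlg : StarSubalgebra ℂ (Hhat V →L[ℂ] Hhat V) :=
  (StarAlgebra.adjoin ℂ (opSystem V 𝔄)).topologicalClosure

/-- The family `𝔉` of the unital C*-subalgebras `𝔅` of `C*(𝒮)` with `Z 𝔄 Z* ⊆ 𝔅` and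
`V̂* 𝔅 V̂ ⊆ 𝔅`. -/
def invariantFamily : Set (StarSubalgebra ℂ (Hhat V →L[ℂ] Hhat V)) :=
  {𝔅 | IsClosed (𝔅 : Set (Hhat V →L[ℂ] Hhat V)) ∧ 𝔅 ≤ opSystemAlg V 𝔄 ∧
    (∀ a ∈ 𝔄, Z V ∘L a ∘L (Z V).adjoint ∈ 𝔅) ∧
    (∀ X ∈ 𝔅, star (Vhat V) * X * Vhat V ∈ 𝔅)}

/-- The dilation algebra `𝔄̂`, the minimal element of the family `𝔉`. As `𝔉` is closed under
intersections, its minimal element is the intersection of all its members. -/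
def dilationAlg : StarSubalgebra ℂ (Hhat V →L[ℂ] Hhat V) := sInf (invariantFamily V 𝔄)

end Nagy

/-! ### Covariant representations of a ucp-map -/

/-- A covariant representation of `Φ`: a faithful unital representation `π` of the C*-algebra on
a Hilbert space and an isometry `V` of that space with `V* π(a) V = π(Φ(a))`. -/
structure CovariantRep {A : Type*} [CStarAlgebra A] [PartialOrder A] [StarOrderedRing A]
    (Φ : A →CP A) (H : Type*) [NormedAddCommGroup H] [InnerProductSpace ℂ H]
    [CompleteSpace H] where
  π : A →⋆ₐ[ℂ] (H →L[ℂ] H)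
  faithful : Function.Injective π
  V : H →ₗᵢ[ℂ] H
  covariant : ∀ a : A, star (Nagy.op V) * π a * Nagy.op V = π (Φ a)

/-! ### The infinite Stinespring representation

Every ucp-map of a concrete C*-algebra has a covariant representation: the direct sum `H_∞` of the
iterated Stinespring spaces, with `π_∞ = ⨁ σ_n` and the isometry
`V_∞ (ξ₀, ξ₁, …) = (0, V₀ ξ₀, V₁ ξ₁, …)`. -/

namespace Stinespring

section Step

variable {A : Type*} [CStarAlgebra A] [PartialOrder A] [StarOrderedRing A]
variable {H : Type*} [NormedAddCommGroup H] [InnerProductSpace ℂ H] [CompleteSpace H]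

lemma inner_rep_star_mul {A : Type*} [CStarAlgebra A] {H : Type*} [NormedAddCommGroup H]
    [InnerProductSpace ℂ H] [CompleteSpace H] (ρ : A →⋆ₐ[ℂ] (H →L[ℂ] H)) (a b : A) (x y : H) :
    ⟪x, ρ (star a * b) y⟫_ℂ = ⟪ρ a x, ρ b y⟫_ℂ := by
  rw [map_mul ρ, map_star ρ, ContinuousLinearMap.star_eq_adjoint]
  exact ContinuousLinearMap.adjoint_inner_right (ρ a) x (ρ b y)

lemma matrix_nonneg (ρ : A →⋆ₐ[ℂ] (H →L[ℂ] H)) {n : Type*} [Fintype n]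
    (M : CStarMatrix n n A) (hM : 0 ≤ M) (x : n → H) :
    0 ≤ ∑ i, ∑ j, ⟪x i, ρ (M i j) (x j)⟫_ℂ := by
  rw [StarOrderedRing.nonneg_iff] at hM
  induction hM using AddSubmonoid.closure_induction with
  | mem M hM =>
    obtain ⟨B, rfl⟩ := hM
    have h4 : ∑ i, ∑ j, ⟪x i, ρ ((star B * B) i j) (x j)⟫_ℂ =
        ∑ l, ⟪∑ i, ρ (B l i) (x i), ∑ j, ρ (B l j) (x j)⟫_ℂ := by
      have h5 : ∀ i j, ⟪x i, ρ ((star B * B) i j) (x j)⟫_ℂ =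
          ∑ l, ⟪ρ (B l i) (x i), ρ (B l j) (x j)⟫_ℂ := by
        intro i j
        rw [CStarMatrix.mul_apply, map_sum, sum_apply, inner_sum]
        exact Finset.sum_congr rfl fun l _ => inner_rep_star_mul ρ (B l i) (B l j) (x i) (x j)
      simp only [h5, sum_inner, inner_sum]
      rw [Finset.sum_congr rfl fun i _ => Finset.sum_comm, Finset.sum_comm]
      exact Finset.sum_congr rfl fun l _ => Finset.sum_comm
    rw [h4]
    refine Finset.sum_nonneg fun l _ => ?_
    rw [inner_self_eq_norm_sq_to_K, ← RCLike.ofReal_pow]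
    exact RCLike.ofReal_nonneg.2 (sq_nonneg _)
  | zero => simp
  | add M N _ _ h1 h2 =>
    have h3 : ∀ i j, ⟪x i, ρ ((M + N) i j) (x j)⟫_ℂ =
        ⟪x i, ρ (M i j) (x j)⟫_ℂ + ⟪x i, ρ (N i j) (x j)⟫_ℂ := by
      intro i j
      rw [CStarMatrix.add_apply, map_add, add_apply, inner_add_right]
    simp only [h3, Finset.sum_add_distrib]
    exact add_nonneg h1 h2

lemma gram_nonneg (Φ : A →CP A) (ρ : A →⋆ₐ[ℂ] (H →L[ℂ] H)) {n : Type*} [Fintype n]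
    (b : n → A) (x : n → H) (c : A) (hc : 0 ≤ c) :
    0 ≤ ∑ i, ∑ j, ⟪x i, ρ (Φ (star (b i) * c * b j)) (x j)⟫_ℂ := by
  classical
  rcases isEmpty_or_nonempty n with h | ⟨⟨k⟩⟩
  · simp
  obtain ⟨d, rfl⟩ := CStarAlgebra.nonneg_iff_eq_star_mul_self.1 hc
  let N : CStarMatrix n n A := fun i j => if i = k then d * b j else 0
  have h := matrix_nonneg ρ _ (Φ.map_cstarMatrix_nonneg (star N * N) (star_mul_self_nonneg N)) x
  have h3 : ∀ i j, (star N * N) i j = star (b i) * (star d * d) * b j := by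
    intro i j
    simp only [CStarMatrix.mul_apply, CStarMatrix.star_apply]
    rw [Finset.sum_eq_single k]
    · simp [N, mul_assoc]
    · intro l _ hl; simp [N, hl]
    · simp
  simpa only [CStarMatrix.map_apply, h3] using h

variable (Φ : A →CP A) (ρ : A →⋆ₐ[ℂ] (H →L[ℂ] H))

/-- Formal sums `∑ a ⊗ x` with `a` in the algebra and `x` in the Hilbert space. -/
def Pre (_Φ : A →CP A) (_ρ : A →⋆ₐ[ℂ] (H →L[ℂ] H)) : Type _ := A →₀ H

instance : AddCommGroup (Pre Φ ρ) := inferInstanceAs (AddCommGroup (A →₀ H))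
instance : Module ℂ (Pre Φ ρ) := inferInstanceAs (Module ℂ (A →₀ H))

/-- The semi-inner product `⟨a ⊗ x, b ⊗ y⟩ = ⟨x, ρ(Φ(a* b)) y⟩`. -/
def form (f g : A →₀ H) : ℂ :=
  f.sum fun a x => g.sum fun b y => ⟪x, ρ (Φ (star a * b)) y⟫_ℂ

lemma form_add_left (f g h : A →₀ H) : form Φ ρ (f + g) h = form Φ ρ f h + form Φ ρ g h := by
  classical
  refine Finsupp.sum_add_index' (by simp) ?_
  intro a x y
  simp only [inner_add_left]
  exact Finsupp.sum_add

lemma form_smul_left (f h : A →₀ H) (r : ℂ) :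
    form Φ ρ (r • f) h = starRingEnd ℂ r * form Φ ρ f h := by
  unfold form
  rw [Finsupp.sum_smul_index' (by simp)]
  simp only [inner_smul_left, Finsupp.sum, Finset.mul_sum]

lemma form_single (a b : A) (x y : H) :
    form Φ ρ (Finsupp.single a x) (Finsupp.single b y) = ⟪x, ρ (Φ (star a * b)) y⟫_ℂ := by
  simp [form]

lemma cp_map_star (a : A) : Φ (star a) = star (Φ a) := map_star Φ a

lemma form_conj (f g : A →₀ H) : starRingEnd ℂ (form Φ ρ g f) = form Φ ρ f g := by
  simp only [form, Finsupp.sum, map_sum, inner_conj_symm]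
  rw [Finset.sum_comm]
  refine Finset.sum_congr rfl fun a _ => Finset.sum_congr rfl fun b _ => ?_
  have : star a * b = star (star b * a) := by simp
  rw [this, cp_map_star, map_star, ContinuousLinearMap.star_eq_adjoint]
  exact (ContinuousLinearMap.adjoint_inner_right _ _ _).symm

/-- The form of two sums multiplied from the left is controlled by a Gram sum. -/
lemma gram_finsupp (f : A →₀ H) (c : A) (hc : 0 ≤ c) :
    0 ≤ ∑ a ∈ f.support, ∑ b ∈ f.support, ⟪f a, ρ (Φ (star a * c * b)) (f b)⟫_ℂ := by
  have := gram_nonneg Φ ρ (n := f.support) (fun i => (i : A)) (fun i => f i) c hc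
  rw [← Finset.sum_coe_sort]
  convert this using 2 with i
  rw [← Finset.sum_coe_sort]

lemma form_self_nonneg (f : A →₀ H) : 0 ≤ form Φ ρ f f := by
  simpa [form, Finsupp.sum] using gram_finsupp Φ ρ f 1 zero_le_one

/-- The semi-inner product space of the formal sums. -/
abbrev preCore : PreInnerProductSpace.Core ℂ (Pre Φ ρ) where
  inner f g := form Φ ρ f g
  conj_inner_symm f g := form_conj Φ ρ f g
  re_inner_nonneg f := (Complex.nonneg_iff.1 (form_self_nonneg Φ ρ f)).1
  add_left f g h := form_add_left Φ ρ f g h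
  smul_left f g r := form_smul_left Φ ρ f g r

instance : SeminormedAddCommGroup (Pre Φ ρ) :=
  InnerProductSpace.Core.toSeminormedAddCommGroup (c := preCore Φ ρ)
instance : InnerProductSpace ℂ (Pre Φ ρ) := InnerProductSpace.ofCore (preCore Φ ρ)

lemma pre_inner_def (f g : Pre Φ ρ) : ⟪f, g⟫_ℂ = form Φ ρ f g := rfl

/-- The Hilbert space `𝔄 ⊗_Φ H`: the completion of the quotient of the formal sums by the null
vectors of the semi-inner product. -/
abbrev Space : Type _ := UniformSpace.Completion (Pre Φ ρ)

/-- A formal sum, as an element of the semi-inner product space. -/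
def toPre (f : A →₀ H) : Pre Φ ρ := f

/-- The class of `a ⊗ x` in `𝔄 ⊗_Φ H`. -/
def tmul (a : A) (x : H) : Space Φ ρ := (toPre Φ ρ (Finsupp.single a x) : Pre Φ ρ)

lemma inner_tmul (a b : A) (x y : H) :
    ⟪tmul Φ ρ a x, tmul Φ ρ b y⟫_ℂ = ⟪x, ρ (Φ (star a * b)) y⟫_ℂ := by
  rw [tmul, tmul, UniformSpace.Completion.inner_coe, pre_inner_def, toPre, toPre, form_single]

lemma span_tmul : (Submodule.span ℂ (Set.range fun p : A × H => tmul Φ ρ p.1 p.2)).topologicalClosure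
    = ⊤ := by
  rw [Submodule.eq_top_iff']
  intro ξ
  induction ξ using UniformSpace.Completion.induction_on with
  | hp => exact Submodule.isClosed_topologicalClosure _
  | ih f =>
    refine Submodule.le_topologicalClosure _ ?_
    obtain ⟨f, rfl⟩ : ∃ g : A →₀ H, toPre Φ ρ g = f := ⟨f, rfl⟩
    induction f using Finsupp.induction_linear with
    | zero => exact Submodule.zero_mem _
    | add f g hf hg =>
      have : (toPre Φ ρ (f + g) : Space Φ ρ) = (toPre Φ ρ f : Space Φ ρ) +
        (toPre Φ ρ g : Space Φ ρ) := UniformSpace.Completion.coe_add _ _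
      rw [this]; exact Submodule.add_mem _ hf hg
    | single a x => exact Submodule.subset_span ⟨(a, x), rfl⟩

lemma ext_tmul {E : Type*} [NormedAddCommGroup E] [NormedSpace ℂ E] {S T : Space Φ ρ →L[ℂ] E}
    (h : ∀ a x, S (tmul Φ ρ a x) = T (tmul Φ ρ a x)) : S = T := by
  refine ContinuousLinearMap.ext_on (s := Set.range fun p : A × H => tmul Φ ρ p.1 p.2) ?_ ?_
  · have := span_tmul Φ ρ
    rwa [Submodule.dense_iff_topologicalClosure_eq_top]
  · rintro _ ⟨p, rfl⟩; exact h p.1 p.2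

lemma eq_of_inner_tmul {ξ η : Space Φ ρ}
    (h : ∀ a x, ⟪tmul Φ ρ a x, ξ⟫_ℂ = ⟪tmul Φ ρ a x, η⟫_ℂ) : ξ = η := by
  refine ext_inner_left ℂ fun ζ => ?_
  have : (innerSL ℂ ξ : Space Φ ρ →L[ℂ] ℂ) = innerSL ℂ η := by
    refine ext_tmul Φ ρ fun a x => ?_
    rw [innerSL_apply_apply, innerSL_apply_apply, ← inner_conj_symm, h, inner_conj_symm]
  have h2 := congrArg (fun T : Space Φ ρ →L[ℂ] ℂ => T ζ) this
  simp only [innerSL_apply_apply] at h2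
  rw [← inner_conj_symm, h2, inner_conj_symm]

lemma form_lmul (c : A) (f : A →₀ H) :
    form Φ ρ (f.mapDomain (c * ·)) (f.mapDomain (c * ·)) =
      ∑ a ∈ f.support, ∑ b ∈ f.support, ⟪f a, ρ (Φ (star a * (star c * c) * b)) (f b)⟫_ℂ := by
  unfold form
  rw [Finsupp.sum_mapDomain_index (by simp)
    (by intros; simp only [inner_add_left]; exact Finsupp.sum_add)]
  refine Finset.sum_congr rfl fun a _ => ?_
  beta_reduce
  rw [Finsupp.sum_mapDomain_index (by simp) (by intros; simp only [map_add, inner_add_right])]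
  refine Finset.sum_congr rfl fun b _ => ?_
  simp only [star_mul, mul_assoc]

lemma form_lmul_le (c : A) (f : A →₀ H) :
    form Φ ρ (f.mapDomain (c * ·)) (f.mapDomain (c * ·)) ≤ ((‖c‖ ^ 2 : ℝ) : ℂ) * form Φ ρ f f := by
  have hc : 0 ≤ algebraMap ℝ A (‖c‖ ^ 2) - star c * c := by
    rw [sub_nonneg, sq, ← CStarRing.norm_star_mul_self (x := c)]
    exact IsSelfAdjoint.le_algebraMap_norm_self (IsSelfAdjoint.star_mul_self c)
  have h := gram_finsupp Φ ρ f _ hc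
  rw [form_lmul, ← sub_nonneg]
  convert h using 1
  simp only [form, Finsupp.sum, Finset.mul_sum, ← Finset.sum_sub_distrib]
  refine Finset.sum_congr rfl fun a _ => Finset.sum_congr rfl fun b _ => ?_
  have : star a * (algebraMap ℝ A (‖c‖ ^ 2) - star c * c) * b =
      ((‖c‖ ^ 2 : ℝ) : ℂ) • (star a * b) - star a * (star c * c) * b := by
    rw [mul_sub, sub_mul, Algebra.algebraMap_eq_smul_one, mul_smul_comm, mul_one, smul_mul_assoc,
      ← Complex.coe_smul]
  rw [this, map_sub, map_sub, map_smul, map_smul, sub_apply, smul_apply, inner_sub_right,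
    inner_smul_right]

/-- Left multiplication on the formal sums, `x ⊗ ψ ↦ c x ⊗ ψ`. -/
def preLmul (c : A) : Pre Φ ρ →L[ℂ] Pre Φ ρ :=
  LinearMap.mkContinuous (Finsupp.lmapDomain H ℂ (c * ·) : (A →₀ H) →ₗ[ℂ] (A →₀ H)) ‖c‖ (by
    intro f
    refine abs_le_of_sq_le_sq' ?_ (by positivity) |>.2
    have h := form_lmul_le Φ ρ c f
    have h1 : ∀ g : Pre Φ ρ, ‖g‖ ^ 2 = (form Φ ρ g g).re := fun g => norm_sq_eq_re_inner (𝕜 := ℂ) g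
    rw [mul_pow, h1, h1]
    have h2 := (Complex.le_def.1 h).1
    rwa [Complex.re_ofReal_mul] at h2)

/-- The operator `σ(c)` on `𝔄 ⊗_Φ H`. -/
def lmul (c : A) : Space Φ ρ →L[ℂ] Space Φ ρ := (preLmul Φ ρ c).completion

lemma lmul_tmul (c a : A) (x : H) : lmul Φ ρ c (tmul Φ ρ a x) = tmul Φ ρ (c * a) x := by
  rw [lmul, tmul, ContinuousLinearMap.completion_apply_coe]
  congr 1
  exact Finsupp.mapDomain_single

/-- The representation `σ` of the algebra on `𝔄 ⊗_Φ H`, `σ(c) (a ⊗ x) = c a ⊗ x`. -/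
def sigma : A →⋆ₐ[ℂ] (Space Φ ρ →L[ℂ] Space Φ ρ) where
  toFun := lmul Φ ρ
  map_one' := ext_tmul Φ ρ fun a x => by simp [lmul_tmul]
  map_mul' c d := ext_tmul Φ ρ fun a x => by
    simp [lmul_tmul, mul_assoc]
  map_zero' := ext_tmul Φ ρ fun a x => eq_of_inner_tmul Φ ρ fun b y => by
    simp [lmul_tmul, inner_tmul]
  map_add' c d := ext_tmul Φ ρ fun a x => eq_of_inner_tmul Φ ρ fun b y => by
    simp [lmul_tmul, inner_tmul, add_mul, mul_add, inner_add_right]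
  commutes' r := ext_tmul Φ ρ fun a x => eq_of_inner_tmul Φ ρ fun b y => by
    simp [lmul_tmul, inner_tmul, Algebra.algebraMap_eq_smul_one, inner_smul_right]
  map_star' c := by
    rw [ContinuousLinearMap.star_eq_adjoint]
    refine ext_tmul Φ ρ fun a x => eq_of_inner_tmul Φ ρ fun b y => ?_
    rw [ContinuousLinearMap.adjoint_inner_right, lmul_tmul, lmul_tmul, inner_tmul, inner_tmul]
    simp [mul_assoc]

/-- The isometry `x ↦ 1 ⊗ x` of `H` into `𝔄 ⊗_Φ H`. -/
def isom (hΦ : Φ 1 = 1) : H →ₗᵢ[ℂ] Space Φ ρ where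
  toFun x := tmul Φ ρ 1 x
  map_add' x y := eq_of_inner_tmul Φ ρ fun b z => by simp [inner_tmul, inner_add_right]
  map_smul' r x := eq_of_inner_tmul Φ ρ fun b z => by simp [inner_tmul, inner_smul_right]
  norm_map' x := by
    have h : ⟪tmul Φ ρ 1 x, tmul Φ ρ 1 x⟫_ℂ = ⟪x, x⟫_ℂ := by
      rw [inner_tmul, star_one, one_mul, hΦ, map_one]; rfl
    rw [@norm_eq_sqrt_re_inner ℂ, @norm_eq_sqrt_re_inner ℂ _ _ _ _ x]
    exact congrArg (fun z : ℂ => √z.re) h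

lemma inner_isom (hΦ : Φ 1 = 1) (a : A) (x y : H) :
    ⟪isom Φ ρ hΦ x, sigma Φ ρ a (isom Φ ρ hΦ y)⟫_ℂ = ⟪x, ρ (Φ a) y⟫_ℂ := by
  have : sigma Φ ρ a (isom Φ ρ hΦ y) = tmul Φ ρ (a * 1) y := lmul_tmul Φ ρ a 1 y
  have h2 := inner_tmul Φ ρ 1 (a * 1) x y
  rw [star_one, one_mul, mul_one] at h2
  rw [this, mul_one]
  exact h2

end Step
lemma inner_conj_isom {H : Type*} [NormedAddCommGroup H] [InnerProductSpace ℂ H]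
    [CompleteSpace H] (V : H →ₗᵢ[ℂ] H) (T : H →L[ℂ] H) (x y : H) :
    ⟪x, (star (Nagy.op V) * T * Nagy.op V) y⟫_ℂ = ⟪V x, T (V y)⟫_ℂ := by
  rw [ContinuousLinearMap.star_eq_adjoint]
  exact ContinuousLinearMap.adjoint_inner_right _ _ _

section Sum

variable {E : ℕ → Type*} [∀ n, NormedAddCommGroup (E n)] [∀ n, InnerProductSpace ℂ (E n)]

/-- The diagonal operator `⨁ T_n` on `⨁ E_n` of a bounded sequence of operators. -/
def diag (T : ∀ n, E n →L[ℂ] E n) (C : ℝ) (hT : ∀ n, ‖T n‖ ≤ C) : lp E 2 →L[ℂ] lp E 2 :=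
  have hC : 0 ≤ C := (norm_nonneg _).trans (hT 0)
  have hle : ∀ (ξ : lp E 2) (n : ℕ), ‖T n (ξ n)‖ ^ (2 : ℝ≥0∞).toReal ≤
      C ^ (2 : ℝ≥0∞).toReal * ‖ξ n‖ ^ (2 : ℝ≥0∞).toReal := fun ξ n => by
    rw [← Real.mul_rpow hC (norm_nonneg _)]
    exact Real.rpow_le_rpow (norm_nonneg _) ((T n).le_of_opNorm_le (hT n) _) (by norm_num)
  have hs : ∀ ξ : lp E 2, Summable fun n => ‖ξ n‖ ^ (2 : ℝ≥0∞).toReal := fun ξ =>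
    (memℓp_gen_iff (by norm_num)).1 (lp.memℓp ξ)
  LinearMap.mkContinuous
    { toFun := fun ξ => ⟨fun n => T n (ξ n), memℓp_gen
        (((hs ξ).mul_left _).of_nonneg_of_le (fun n => by positivity) (hle ξ))⟩
      map_add' := fun ξ η => by ext n; exact map_add (T n) _ _
      map_smul' := fun r ξ => by ext n; exact map_smul (T n) r _ } C (fun ξ => by
    refine lp.norm_le_of_tsum_le (by norm_num) (by positivity) ?_
    rw [Real.mul_rpow hC (norm_nonneg _), lp.norm_rpow_eq_tsum (by norm_num) ξ, ← tsum_mul_left]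
    exact Summable.tsum_le_tsum (hle ξ)
      (((hs ξ).mul_left _).of_nonneg_of_le (fun n => by positivity) (hle ξ))
      ((hs ξ).mul_left _))

@[simp] lemma diag_apply (T : ∀ n, E n →L[ℂ] E n) (C : ℝ) (hT : ∀ n, ‖T n‖ ≤ C) (ξ : lp E 2)
    (n : ℕ) : diag T C hT ξ n = T n (ξ n) := rfl

/-- The sequence `(0, T₀ ξ₀, T₁ ξ₁, …)`. -/
def shiftSeq (T : ∀ n, E n →ₗᵢ[ℂ] E (n + 1)) (ξ : ∀ n, E n) : ∀ n, E n
  | 0 => 0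
  | n + 1 => T n (ξ n)

/-- The weighted right shift `(ξ₀, ξ₁, …) ↦ (0, T₀ ξ₀, T₁ ξ₁, …)` on `⨁ E_n`. -/
def shift (T : ∀ n, E n →ₗᵢ[ℂ] E (n + 1)) : lp E 2 →ₗᵢ[ℂ] lp E 2 where
  toFun ξ := ⟨shiftSeq T ξ, memℓp_gen ((summable_nat_add_iff 1).1 (by
    simpa [shiftSeq] using (memℓp_gen_iff (p := 2) (by norm_num)).1 (lp.memℓp ξ)))⟩
  map_add' ξ η := by
    ext n
    cases n with
    | zero => exact (add_zero (0 : E 0)).symm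
    | succ n => exact map_add (T n) _ _
  map_smul' r ξ := by
    ext n
    cases n with
    | zero => exact (smul_zero r).symm
    | succ n => exact map_smul (T n) r _
  norm_map' ξ := by
    have h := (memℓp_gen_iff (p := 2) (by norm_num)).1 (lp.memℓp ξ)
    rw [lp.norm_eq_tsum_rpow (by norm_num), lp.norm_eq_tsum_rpow (by norm_num)]
    congr 1
    change ∑' n, ‖shiftSeq T ξ n‖ ^ (2 : ℝ≥0∞).toReal = _
    rw [Summable.tsum_eq_zero_add ((summable_nat_add_iff 1).1 (by simpa [shiftSeq] using h))]
    simp [shiftSeq]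

@[simp] lemma shift_zero (T : ∀ n, E n →ₗᵢ[ℂ] E (n + 1)) (ξ : lp E 2) : shift T ξ 0 = 0 := rfl

@[simp] lemma shift_succ (T : ∀ n, E n →ₗᵢ[ℂ] E (n + 1)) (ξ : lp E 2) (n : ℕ) :
    shift T ξ (n + 1) = T n (ξ n) := rfl

end Sum

section Tower

universe u

/-- A Hilbert space with a unital representation of the algebra. -/
structure Rep (A : Type u) [CStarAlgebra A] : Type (u + 1) where
  carrier : Type u
  [normed : NormedAddCommGroup carrier]
  [inner : InnerProductSpace ℂ carrier]
  [complete : CompleteSpace carrier]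
  rep : A →⋆ₐ[ℂ] (carrier →L[ℂ] carrier)

attribute [instance] Rep.normed Rep.inner Rep.complete

variable {A : Type u} [CStarAlgebra A] [PartialOrder A] [StarOrderedRing A]

/-- The representations `(H_n, σ_n)`: `H₀` is the given one, and
`H_{n+1} = 𝔄 ⊗_{Φ_n} H_n` with `Φ_n = σ_n ∘ Φ`. -/
def tower (Φ : A →CP A) (R : Rep A) : ℕ → Rep A
  | 0 => R
  | n + 1 => { carrier := Space Φ (tower Φ R n).rep, rep := sigma Φ (tower Φ R n).rep }

variable (Φ : A →CP A) (hΦ : Φ 1 = 1) (R : Rep A)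

/-- The isometry `V_n : H_n → H_{n+1}`. -/
def towerIsom (n : ℕ) : (tower Φ R n).carrier →ₗᵢ[ℂ] (tower Φ R (n + 1)).carrier :=
  isom Φ (tower Φ R n).rep hΦ

/-- The Hilbert space `H_∞ = ⨁ H_n`. -/
abbrev Hinf : Type u := lp (fun n => (tower Φ R n).carrier) 2

/-- The representation `π_∞ = ⨁ σ_n`. -/
def piInf : A →⋆ₐ[ℂ] (Hinf Φ R →L[ℂ] Hinf Φ R) where
  toFun a := diag (fun n => (tower Φ R n).rep a) ‖a‖
    (fun n => NonUnitalStarAlgHom.norm_apply_le (tower Φ R n).rep a)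
  map_one' := by ext ξ n; simp
  map_mul' a b := by ext ξ n; simp
  map_zero' := by ext ξ n; simp
  map_add' a b := by ext ξ n; simp
  commutes' r := by ext ξ n; simp [Algebra.algebraMap_eq_smul_one]
  map_star' a := by
    rw [ContinuousLinearMap.star_eq_adjoint, ContinuousLinearMap.eq_adjoint_iff]
    intro ξ η
    rw [lp.inner_eq_tsum, lp.inner_eq_tsum]
    refine tsum_congr fun n => ?_
    rw [diag_apply, diag_apply, map_star, ContinuousLinearMap.star_eq_adjoint,
      ContinuousLinearMap.adjoint_inner_left]

/-- The isometry `V_∞ (ξ₀, ξ₁, …) = (0, V₀ ξ₀, V₁ ξ₁, …)`. -/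
def Vinf : Hinf Φ R →ₗᵢ[ℂ] Hinf Φ R := shift (towerIsom Φ hΦ R)

lemma piInf_apply (a : A) (ξ : Hinf Φ R) (n : ℕ) :
    piInf Φ R a ξ n = (tower Φ R n).rep a (ξ n) := rfl

lemma piInf_injective (hR : Function.Injective R.rep) : Function.Injective (piInf Φ R) := by
  intro a b h
  refine hR (ContinuousLinearMap.ext fun x => ?_)
  let x0 : (tower Φ R 0).carrier := x
  let y : Hinf Φ R := lp.single 2 0 x0
  have hy : y 0 = x0 := lp.single_apply_self (E := fun n => (tower Φ R n).carrier) 2 0 x0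
  have h1 : piInf Φ R a y 0 = piInf Φ R b y 0 := by rw [h]
  rw [piInf_apply, piInf_apply, hy] at h1
  exact h1

lemma inner_Vinf (a : A) (ξ η : Hinf Φ R) :
    ⟪Vinf Φ hΦ R η, piInf Φ R a (Vinf Φ hΦ R ξ)⟫_ℂ = ⟪η, piInf Φ R (Φ a) ξ⟫_ℂ := by
  have hs := lp.summable_inner (𝕜 := ℂ) (Vinf Φ hΦ R η) (piInf Φ R a (Vinf Φ hΦ R ξ))
  rw [lp.inner_eq_tsum, lp.inner_eq_tsum, hs.tsum_eq_zero_add]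
  have h0 : ⟪Vinf Φ hΦ R η 0, piInf Φ R a (Vinf Φ hΦ R ξ) 0⟫_ℂ = 0 := inner_zero_left _
  rw [h0, zero_add]
  refine tsum_congr fun n => ?_
  rw [piInf_apply, piInf_apply]
  exact inner_isom Φ (tower Φ R n).rep hΦ a (η n) (ξ n)

/-- The infinite Stinespring representation `(π_∞, H_∞, V_∞)` of a concrete C*-algebra with a
ucp-map is a covariant representation. -/
def covariantRep (hR : Function.Injective R.rep) : CovariantRep Φ (Hinf Φ R) where
  π := piInf Φ R
  faithful := piInf_injective Φ R hR
  V := Vinf Φ hΦ R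
  covariant a := by
    refine ContinuousLinearMap.ext fun ξ => ext_inner_left ℂ fun η => ?_
    exact (inner_conj_isom (Vinf Φ hΦ R) (piInf Φ R a) η ξ).trans (inner_Vinf Φ hΦ R a ξ η)

end Tower

end Stinespring

end

noncomputable section

namespace Nagy

/-! ### The defect projection and the shift on `l²(F H)` -/

section Dilation

variable {H : Type*} [NormedAddCommGroup H] [InnerProductSpace ℂ H] [CompleteSpace H]
variable (V : H →ₗᵢ[ℂ] H)

/-! The correlations are bounded sesquilinear expressions in the two columns `P = X* Z` and `Q = Y
Z`. Since `V̂^k Z = Z V^k`, the operator `Z* X V̂^{k*} Y V̂^k Z` equals `P* V̂^{k*} Q V^k`, so it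
suffices to know which columns occur and to test the limit on generators.

The columns that occur lie in the closed span of `Z A` with `A ∈ 𝔄` and `J Π_j* |α)` with `weight α
= j + 1`. This space contains `Z`, is invariant under `C*(𝒮)` (`comp_mem_columns`) and is compressed
into `𝔄` by `Z*`. The algebra behind it is that `V* A V ∈ 𝔄` lets a bra cancel against a heavier ket
(`bra_mul_ket`), and that `F |γ)` is a difference of kets of the same weight (`F_mul_ket`). The
dilation algebra is contained in `C*(𝒮)`, because `C*(𝒮)` is itself stable under `V̂* · V̂`
(`conj_Vhat_mem_opSystemAlg`).

With `b = Z* Q ∈ 𝔄`, a generator `P = Z a*` gives exactly `φ(a Φ^k(b)) - φ(a) φ(b)`. A generator `P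
= J Π_j* |α)` is orthogonal to `Z` and reaches `H` after `j + 1` steps, `V̂^{l+j+1} J Π_j* = Z V^l
F`; from then on its correlation is a bra times `F Φ^l(b) V^{weight α}`. The `φ`-adjoint turns `c ↦
(α| c V^{weight α}` into a density `φ(d c)` (`exists_bra_density`), and `F` makes the correlation a
difference `φ(d Φ^l(b)) - φ(e Φ^l(b))` with `φ(d) = φ(e)` (`exists_bra_mul_F`). Both cases thus
reduce to the hypothesis on `Φ`. The bound of `norm_correlation_le`, uniform in `k`, passes the
result to the closed span (`correlation_mem`). Ergodicity and weak mixing enter only through a space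
of null sequences closed under uniform limits and prepending terms, so one argument serves both. -/

lemma star_F : star (F V) = F V := by simp [F]

lemma adjoint_F : (F V).adjoint = F V := star_F V

lemma F_mul_op : F V * op V = 0 := by
  rw [F, sub_mul, mul_assoc, star_op_mul_op, one_mul, mul_one, sub_self]

lemma star_op_mul_F : star (op V) * F V = 0 := by
  simpa [star_F] using congrArg star (F_mul_op V)

/-- The entries of a sequence in `l²(F H)` are already fixed by `F`; this makes the factors `F` next
to `Π_j` in gamma and napla operators redundant. -/
lemma F_comp_proj (j : ℕ) : F V ∘L proj V j = proj V j :=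
  ContinuousLinearMap.ext fun ξ => (mem_defect_iff V _).1 (ξ j).2

lemma adjoint_proj_comp_F (j : ℕ) : (proj V j).adjoint ∘L F V = (proj V j).adjoint := by
  simpa [ContinuousLinearMap.adjoint_comp, adjoint_F] using
    congrArg ContinuousLinearMap.adjoint (F_comp_proj V j)

lemma proj_comp_W (j : ℕ) : proj V j ∘L W V = proj V (j + 1) := rfl

/-- The vector `F x`, as an element of `F H`. -/
def toFH (x : H) : FH V := (⟨F V x, x, rfl⟩ : defect V)

lemma incl_toFH (x : H) : incl V (toFH V x) = F V x := rfl

lemma adjoint_proj_apply (j : ℕ) (x : H) :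
    (proj V j).adjoint x = lp.single (E := fun _ : ℕ => FH V) 2 j (toFH V x) := by
  refine ext_inner_right ℂ fun ξ => ?_
  have h : F V (proj V j ξ) = proj V j ξ := congrArg (fun T => T ξ) (F_comp_proj V j)
  have h1 : ⟪F V x, proj V j ξ⟫_ℂ = ⟪toFH V x, ξ j⟫_ℂ := rfl
  rw [ContinuousLinearMap.adjoint_inner_left, lp.inner_single_left, ← h1, ← h,
    ← ContinuousLinearMap.adjoint_inner_left, adjoint_F, h]

lemma proj_comp_adjoint_proj (i j : ℕ) :
    proj V i ∘L (proj V j).adjoint = if i = j then F V else 0 := by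
  ext x
  rw [ContinuousLinearMap.comp_apply, adjoint_proj_apply]
  change incl V ((lp.single (E := fun _ : ℕ => FH V) 2 j (toFH V x) : L2 V) i) = _
  split_ifs with h
  · subst h
    rw [lp.single_apply_self, incl_toFH]
  · rw [lp.single_apply_ne _ _ _ h]; exact map_zero _

lemma proj_injective {ξ η : L2 V} (h : ∀ j, proj V j ξ = proj V j η) : ξ = η :=
  lp.ext (funext fun j => Subtype.ext (h j))

lemma W_comp_adjoint_proj_zero : W V ∘L (proj V 0).adjoint = 0 := by
  refine ContinuousLinearMap.ext fun x => proj_injective V fun j => ?_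
  have := congrArg (fun T => T x) (proj_comp_adjoint_proj V (j + 1) 0)
  simpa [← proj_comp_W] using this

lemma W_comp_adjoint_proj_succ (j : ℕ) :
    W V ∘L (proj V (j + 1)).adjoint = (proj V j).adjoint := by
  refine ContinuousLinearMap.ext fun x => proj_injective V fun i => ?_
  have h1 := congrArg (fun T => T x) (proj_comp_adjoint_proj V (i + 1) (j + 1))
  have h2 := congrArg (fun T => T x) (proj_comp_adjoint_proj V i j)
  simp only [Nat.add_right_cancel_iff, ContinuousLinearMap.comp_apply] at h1 h2
  exact h1.trans h2.symm

/-- Splitting off the zeroth term of the series for the inner product gives this resolution of the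
identity. -/
lemma adjoint_W_comp_W :
    (proj V 0).adjoint ∘L proj V 0 + (W V).adjoint ∘L W V = 1 := by
  refine ContinuousLinearMap.ext fun ξ => ext_inner_left ℂ fun η => ?_
  have hs := lp.summable_inner (𝕜 := ℂ) η ξ
  simp only [add_apply, ContinuousLinearMap.comp_apply, inner_add_right,
    ContinuousLinearMap.adjoint_inner_right, one_apply_eq_self]
  rw [lp.inner_eq_tsum η, hs.tsum_eq_zero_add, lp.inner_eq_tsum]
  rfl

lemma W_surjective : Function.Surjective (W V) := fun ξ =>
  ⟨Stinespring.shift (E := fun _ => FH V) (fun _ => LinearIsometry.id) ξ,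
    lp.ext (funext fun _ => rfl)⟩

lemma W_comp_adjoint_W : W V ∘L (W V).adjoint = 1 := by
  -- Since `W Π_0* = 0`, multiplying the resolution of the identity by `W` leaves `W W* W = W`;
  -- surjectivity of `W` cancels the right factor.
  have h : W V ∘L ((proj V 0).adjoint ∘L proj V 0 + (W V).adjoint ∘L W V) = W V := by
    rw [adjoint_W_comp_W]; rfl
  rw [ContinuousLinearMap.comp_add, ← ContinuousLinearMap.comp_assoc, W_comp_adjoint_proj_zero,
    ContinuousLinearMap.zero_comp, zero_add] at h
  refine ContinuousLinearMap.ext fun ξ => ?_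
  obtain ⟨η, rfl⟩ := W_surjective V ξ
  exact congrArg (fun T => T η) h

/-! ### Operator matrices and unitarity of the dilation -/

/-- The isometric embedding `ξ ↦ 0 ⊕ ξ` of `l²(F H)` into `Ĥ`. -/
def J : L2 V →L[ℂ] Hhat V :=
  (WithLp.prodContinuousLinearEquiv 2 ℂ H (L2 V)).symm.toContinuousLinearMap ∘L
    ContinuousLinearMap.inr ℂ H (L2 V)

lemma Hhat_ext {x y : Hhat V} (h1 : x.fst = y.fst) (h2 : x.snd = y.snd) : x = y := by
  cases x; cases y; exact congrArg _ (Prod.ext h1 h2)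

section Block

variable (a a' : H →L[ℂ] H) (b b' : L2 V →L[ℂ] H) (c c' : H →L[ℂ] L2 V)
  (d d' : L2 V →L[ℂ] L2 V)

@[simp] lemma block_apply_fst (x : Hhat V) : (block V a b c d x).fst = a x.fst + b x.snd := rfl
@[simp] lemma block_apply_snd (x : Hhat V) : (block V a b c d x).snd = c x.fst + d x.snd := rfl
@[simp] lemma Z_apply_fst (x : H) : (Z V x).fst = x := rfl
@[simp] lemma Z_apply_snd (x : H) : (Z V x).snd = 0 := rfl
@[simp] lemma J_apply_fst (x : L2 V) : (J V x).fst = 0 := rfl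
@[simp] lemma J_apply_snd (x : L2 V) : (J V x).snd = x := rfl

lemma block_comp_Z : block V a b c d ∘L Z V = Z V ∘L a + J V ∘L c :=
  ContinuousLinearMap.ext fun x => Hhat_ext V (by simp) (by simp)

lemma block_comp_J : block V a b c d ∘L J V = Z V ∘L b + J V ∘L d :=
  ContinuousLinearMap.ext fun x => Hhat_ext V (by simp) (by simp)

lemma block_mul_block : block V a b c d * block V a' b' c' d' =
    block V (a ∘L a' + b ∘L c') (a ∘L b' + b ∘L d') (c ∘L a' + d ∘L c') (c ∘L b' + d ∘L d') :=
  ContinuousLinearMap.ext fun x => Hhat_ext V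
    (by simp [add_add_add_comm]) (by simp [add_add_add_comm])

lemma block_add_block : block V a b c d + block V a' b' c' d' =
    block V (a + a') (b + b') (c + c') (d + d') :=
  ContinuousLinearMap.ext fun x => Hhat_ext V
    (by simp [add_add_add_comm]) (by simp [add_add_add_comm])

lemma block_one : block V 1 0 0 1 = 1 :=
  ContinuousLinearMap.ext fun x => Hhat_ext V (by simp) (by simp)

lemma star_block : star (block V a b c d) =
    block V a.adjoint c.adjoint b.adjoint d.adjoint := by
  rw [ContinuousLinearMap.star_eq_adjoint]
  symm
  rw [ContinuousLinearMap.eq_adjoint_iff]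
  intro x y
  simp only [WithLp.prod_inner_apply, block_apply_fst, block_apply_snd, WithLp.ofLp_fst,
    WithLp.ofLp_snd, inner_add_left, inner_add_right, ContinuousLinearMap.adjoint_inner_left]
  exact add_add_add_comm _ _ _ _

end Block

lemma adjoint_Z_comp_Z : (Z V).adjoint ∘L Z V = 1 := by
  refine ContinuousLinearMap.ext fun x => ext_inner_left ℂ fun y => ?_
  simp [ContinuousLinearMap.adjoint_inner_right, WithLp.prod_inner_apply]

lemma adjoint_Z_comp_J : (Z V).adjoint ∘L J V = 0 := by
  refine ContinuousLinearMap.ext fun x => ext_inner_left ℂ fun y => ?_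
  simp [ContinuousLinearMap.adjoint_inner_right, WithLp.prod_inner_apply]

lemma adjoint_J_comp_Z : (J V).adjoint ∘L Z V = 0 := by
  simpa [ContinuousLinearMap.adjoint_comp] using
    congrArg ContinuousLinearMap.adjoint (adjoint_Z_comp_J V)

lemma block_corner (a : H →L[ℂ] H) : Z V ∘L a ∘L (Z V).adjoint = block V a 0 0 0 := by
  have h : (Z V).adjoint = ContinuousLinearMap.fst ℂ H (L2 V) ∘L
      (WithLp.prodContinuousLinearEquiv 2 ℂ H (L2 V)).toContinuousLinearMap := by
    symm
    rw [ContinuousLinearMap.eq_adjoint_iff]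
    intro x y
    simp [WithLp.prod_inner_apply]
  rw [h]
  exact ContinuousLinearMap.ext fun x => Hhat_ext V (by simp) (by simp)

lemma star_Vhat : star (Vhat V) =
    block V (star (op V)) 0 ((proj V 0).adjoint ∘L F V) (W V).adjoint := by
  rw [Vhat, star_block, ContinuousLinearMap.adjoint_comp, adjoint_F, map_zero]; rfl

lemma star_Vhat_mul_Vhat : star (Vhat V) * Vhat V = 1 := by
  have h1 : star (op V) ∘L F V = 0 := star_op_mul_F V
  have h2 : F V ∘L op V = 0 := F_mul_op V
  have h3 : star (op V) ∘L op V = 1 := star_op_mul_op V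
  rw [star_Vhat, Vhat, block_mul_block, ← block_one, F_comp_proj, adjoint_proj_comp_F,
    adjoint_W_comp_W, h3]
  congr 1
  · simp
  · rw [← F_comp_proj, ← ContinuousLinearMap.comp_assoc, h1]; simp
  · rw [← adjoint_proj_comp_F, ContinuousLinearMap.comp_assoc, h2]; simp

lemma Vhat_mul_star_Vhat : Vhat V * star (Vhat V) = 1 := by
  have h3 : op V ∘L star (op V) = 1 - F V := by simp [F]; rfl
  have h4 : proj V 0 ∘L (W V).adjoint = 0 := by
    simpa [ContinuousLinearMap.adjoint_comp] using
      congrArg ContinuousLinearMap.adjoint (W_comp_adjoint_proj_zero V)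
  rw [star_Vhat, Vhat, block_mul_block, ← block_one, F_comp_proj, adjoint_proj_comp_F,
    W_comp_adjoint_W, h3, h4, W_comp_adjoint_proj_zero, proj_comp_adjoint_proj]
  congr 1 <;> simp

lemma Vhat_comp_Z : Vhat V ∘L Z V = Z V ∘L op V := by
  rw [Vhat, block_comp_Z]; simp

lemma Vhat_pow_comp_Z (k : ℕ) : (Vhat V ^ k) ∘L Z V = Z V ∘L (op V ^ k) := by
  induction k with
  | zero => rfl
  | succ k ih =>
    rw [pow_succ, pow_succ, ContinuousLinearMap.mul_def, ContinuousLinearMap.mul_def,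
      ContinuousLinearMap.comp_assoc, Vhat_comp_Z, ← ContinuousLinearMap.comp_assoc, ih,
      ContinuousLinearMap.comp_assoc]

/-- Each application of `V̂` moves the entry one place down in `l²(F H)`; the entry at place `0` is
delivered to `H` by the next step, hence `j + 1` steps. -/
lemma Vhat_pow_comp_J (j : ℕ) :
    (Vhat V ^ (j + 1)) ∘L J V ∘L (proj V j).adjoint = Z V ∘L F V := by
  have h (j : ℕ) : Vhat V ∘L J V ∘L (proj V j).adjoint =
      Z V ∘L proj V 0 ∘L (proj V j).adjoint + J V ∘L W V ∘L (proj V j).adjoint := by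
    rw [← ContinuousLinearMap.comp_assoc, Vhat, block_comp_J, F_comp_proj]; rfl
  induction j with
  | zero =>
    rw [zero_add, pow_one, h, proj_comp_adjoint_proj, W_comp_adjoint_proj_zero]
    simp
  | succ j ih =>
    rw [pow_succ, ContinuousLinearMap.mul_def, ContinuousLinearMap.comp_assoc, h,
      proj_comp_adjoint_proj, W_comp_adjoint_proj_succ]
    simp [ih]

lemma Vhat_pow_add_comp_J (l j : ℕ) :
    (Vhat V ^ (l + (j + 1))) ∘L J V ∘L (proj V j).adjoint = Z V ∘L (op V ^ l) ∘L F V := by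
  rw [pow_add, ContinuousLinearMap.mul_def, ContinuousLinearMap.comp_assoc, Vhat_pow_comp_J,
    ← ContinuousLinearMap.comp_assoc, Vhat_pow_comp_Z, ContinuousLinearMap.comp_assoc]

end Dilation

/-! ### Calculus of strings -/

section Strings

variable {H : Type*} [NormedAddCommGroup H] [InnerProductSpace ℂ H] [CompleteSpace H]
variable (V : H →ₗᵢ[ℂ] H) {𝔄 : StarSubalgebra ℂ (H →L[ℂ] H)}

/-- The string `(n₁, …, n_r, A₁*, …, A_r*)`. -/
def starStr (α : Str 𝔄) : Str 𝔄 := α.map fun p => (p.1, star p.2)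

@[simp] lemma weight_nil : weight ([] : Str 𝔄) = 0 := rfl

@[simp] lemma weight_cons (p : ℕ × 𝔄) (α : Str 𝔄) : weight (p :: α) = p.1 + weight α := by
  simp [weight]

@[simp] lemma weight_append (α β : Str 𝔄) : weight (α ++ β) = weight α + weight β := by
  simp [weight]

@[simp] lemma weight_starStr (α : Str 𝔄) : weight (starStr α) = weight α := by
  induction α with
  | nil => rfl
  | cons p α ih => simpa [starStr] using ih

@[simp] lemma starStr_starStr (α : Str 𝔄) : starStr (starStr α) = α := by
  simp [starStr, Function.comp_def]

lemma star_ket (α : Str 𝔄) : star (ket V α) = bra V (starStr α) := by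
  induction α with
  | nil => simp [ket, bra, starStr]
  | cons p α ih =>
    have : starStr (p :: α) = (p.1, star p.2) :: starStr α := rfl
    simp [ket, this, bra, ih, mul_assoc]

lemma star_bra (α : Str 𝔄) : star (bra V α) = ket V (starStr α) := by
  rw [star_eq_iff_star_eq, star_ket, starStr_starStr]

lemma ket_append (α β : Str 𝔄) : ket V (α ++ β) = ket V α * ket V β := by
  induction α with
  | nil => simp [ket]
  | cons p α ih => simp [ket, ih, mul_assoc]

lemma bra_append (α β : Str 𝔄) : bra V (α ++ β) = bra V β * bra V α := by
  induction α with
  | nil => simp [bra]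
  | cons p α ih => simp [bra, ih, mul_assoc]

lemma ket_zero_cons (a : 𝔄) (α : Str 𝔄) : ket V ((0, a) :: α) = a * ket V α := by simp [ket]

lemma ket_one_cons (n : ℕ) (α : Str 𝔄) : ket V ((n, 1) :: α) = op V ^ n * ket V α := by simp [ket]

variable {V}

/-- `V*` meets the first positive power of `V`, and `V* A V ∈ 𝔄` absorbs everything between them at
the cost of one unit of weight. -/
lemma star_op_mul_ket (h𝔄 : ∀ a ∈ 𝔄, star (op V) * a * op V ∈ 𝔄)
    (α : Str 𝔄) (hα : 1 ≤ weight α) :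
    ∃ β : Str 𝔄, star (op V) * ket V α = ket V β ∧ weight β + 1 = weight α := by
  -- Letters of weight zero at the front have to be collected in a coefficient, so the induction
  -- carries an arbitrary left factor `a`.
  suffices h : ∀ a : 𝔄, ∃ β : Str 𝔄,
      star (op V) * ((a : H →L[ℂ] H) * ket V α) = ket V β ∧ weight β + 1 = weight α by
    simpa using h 1
  induction α with
  | nil => simp at hα
  | cons p α ih =>
    obtain ⟨n, b⟩ := p
    intro a
    cases n with
    | zero =>
      obtain ⟨β, h1, h2⟩ := ih (by simpa using hα) (a * b)
      exact ⟨β, by rw [← h1]; simp [ket, mul_assoc], by simpa using h2⟩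
    | succ n =>
      refine ⟨(n, ⟨_, h𝔄 _ (a * b).2⟩) :: α, ?_, by simp; omega⟩
      simp [ket, mul_assoc, pow_succ']

lemma star_op_pow_mul_ket (h𝔄 : ∀ a ∈ 𝔄, star (op V) * a * op V ∈ 𝔄)
    (n : ℕ) (α : Str 𝔄) (hα : n ≤ weight α) :
    ∃ β : Str 𝔄, star (op V) ^ n * ket V α = ket V β ∧ weight β + n = weight α := by
  induction n generalizing α with
  | zero => exact ⟨α, by simp, rfl⟩
  | succ n ih =>
    obtain ⟨β, h1, h2⟩ := star_op_mul_ket h𝔄 α (by omega)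
    obtain ⟨γ, h3, h4⟩ := ih β (by omega)
    exact ⟨γ, by rw [← h3, ← h1, pow_succ, mul_assoc], by omega⟩

lemma bra_mul_ket (h𝔄 : ∀ a ∈ 𝔄, star (op V) * a * op V ∈ 𝔄)
    (α β : Str 𝔄) (h : weight α ≤ weight β) :
    ∃ γ : Str 𝔄, bra V α * ket V β = ket V γ ∧ weight γ + weight α = weight β := by
  induction α generalizing β with
  | nil => exact ⟨β, by simp [bra], by simp⟩
  | cons p α ih =>
    obtain ⟨n, a⟩ := p
    rw [weight_cons] at h
    obtain ⟨γ, h1, h2⟩ := star_op_pow_mul_ket h𝔄 n ((0, a) :: β) (by simp; omega)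
    simp only [weight_cons, zero_add] at h2
    obtain ⟨δ, h3, h4⟩ := ih γ (by simp at h; omega)
    refine ⟨δ, ?_, by rw [weight_cons]; omega⟩
    rw [← h3, ← h1, ket_zero_cons, bra]
    simp only [mul_assoc]

lemma op_mul_star_op_mul_ket (h𝔄 : ∀ a ∈ 𝔄, star (op V) * a * op V ∈ 𝔄)
    (α : Str 𝔄) (hα : 1 ≤ weight α) :
    ∃ β : Str 𝔄, op V * (star (op V) * ket V α) = ket V β ∧ weight β = weight α := by
  obtain ⟨β, h1, h2⟩ := star_op_mul_ket h𝔄 α hα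
  exact ⟨(1, 1) :: β, by rw [h1, ket_one_cons, pow_one], by simp; omega⟩

/-- `V V* |α)` is again a ket: `V*` removes one unit of weight, and prepending the letter `(1, 1)`
restores it. -/
lemma F_mul_ket (h𝔄 : ∀ a ∈ 𝔄, star (op V) * a * op V ∈ 𝔄)
    (α : Str 𝔄) (hα : 1 ≤ weight α) :
    ∃ β : Str 𝔄, F V * ket V α = ket V α - ket V β ∧ weight β = weight α := by
  obtain ⟨β, h1, h2⟩ := op_mul_star_op_mul_ket h𝔄 α hα
  exact ⟨β, by rw [← h1, F, sub_mul, one_mul, mul_assoc], h2⟩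

lemma ket_mem (α : Str 𝔄) (hα : weight α = 0) : ket V α ∈ 𝔄 := by
  induction α with
  | nil => exact one_mem 𝔄
  | cons p α ih =>
    obtain ⟨n, a⟩ := p
    rw [weight_cons, Nat.add_eq_zero_iff] at hα
    obtain ⟨rfl, h⟩ := hα
    rw [ket_zero_cons]
    exact mul_mem a.2 (ih h)

/-! ### Gamma and napla operators, and the algebra `C*(𝒮)` -/

variable (V)

lemma Gam_eq (α : Str 𝔄) : Gam V α = bra V α ∘L proj V (weight α - 1) := by
  rw [Gam, F_comp_proj]

lemma adjoint_Gam (α : Str 𝔄) :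
    (Gam V α).adjoint = (proj V (weight α - 1)).adjoint ∘L ket V (starStr α) := by
  rw [Gam_eq, ContinuousLinearMap.adjoint_comp, ← star_bra]; rfl

lemma Nap_eq (k : ℕ) (a : 𝔄) (α β : Str 𝔄) : Nap V k a α β =
    (proj V (weight α + k)).adjoint ∘L (ket V α * (a : H →L[ℂ] H) * bra V β) ∘L
      proj V (weight β + k) := by
  rw [Nap]
  conv_rhs => rw [← adjoint_proj_comp_F, ← F_comp_proj V (weight β + k)]
  rfl

lemma adjoint_Nap (k : ℕ) (a : 𝔄) (α β : Str 𝔄) :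
    (Nap V k a α β).adjoint = Nap V k (star a) (starStr β) (starStr α) := by
  have h : (ket V α * (a : H →L[ℂ] H) * bra V β).adjoint =
      ket V (starStr β) * ((star a : 𝔄) : H →L[ℂ] H) * bra V (starStr α) := by
    rw [← star_bra, ← star_ket, ← ContinuousLinearMap.star_eq_adjoint]
    simp [mul_assoc]
  rw [Nap_eq, Nap_eq, ContinuousLinearMap.adjoint_comp, ContinuousLinearMap.adjoint_comp, h,
    ContinuousLinearMap.adjoint_adjoint, weight_starStr, weight_starStr]
  rfl

variable (𝔄) in
lemma Nap_mem (k : ℕ) (a : 𝔄) (α β : Str 𝔄) : Nap V k a α β ∈ napAlg V 𝔄 :=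
  Submodule.le_topologicalClosure _ (Submodule.subset_span ⟨k, a, α, β, rfl⟩)

/-- A closed property of operators that is compatible with the linear structure holds on `𝔛` if it
holds for the napla operators. -/
lemma napAlg_le {S : Submodule ℂ (L2 V →L[ℂ] L2 V)}
    (hS : IsClosed (S : Set (L2 V →L[ℂ] L2 V)))
    (h : ∀ (k : ℕ) (a : 𝔄) (α β : Str 𝔄), Nap V k a α β ∈ S) : napAlg V 𝔄 ≤ S := by
  refine Submodule.topologicalClosure_minimal _ (Submodule.span_le.2 ?_) hS
  rintro _ ⟨k, a, α, β, rfl⟩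
  exact h k a α β

lemma isClosed_napAlg : IsClosed (napAlg V 𝔄 : Set (L2 V →L[ℂ] L2 V)) :=
  Submodule.isClosed_topologicalClosure _

lemma adjoint_mem_napAlg {T : L2 V →L[ℂ] L2 V} (hT : T ∈ napAlg V 𝔄) :
    T.adjoint ∈ napAlg V 𝔄 := by
  let S : Submodule ℂ (L2 V →L[ℂ] L2 V) :=
    { carrier := {T | star T ∈ napAlg V 𝔄}
      add_mem' := fun {a b} ha hb => by
        simpa only [Set.mem_ofPred_eq, star_add] using add_mem ha hb
      zero_mem' := by simp
      smul_mem' := fun c T hT => by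
        simpa only [Set.mem_ofPred_eq, star_smul] using Submodule.smul_mem _ (star c) hT }
  refine napAlg_le V (S := S) ((isClosed_napAlg V).preimage continuous_star) ?_ hT
  intro k a α β
  change (Nap V k a α β).adjoint ∈ napAlg V 𝔄
  rw [adjoint_Nap]
  exact Nap_mem V 𝔄 _ _ _ _

/-- Conjugation by the shift raises the parameter `k` of a napla operator by one, as `Π_j W =
Π_{j+1}`. -/
lemma conj_W_mem_napAlg {T : L2 V →L[ℂ] L2 V} (hT : T ∈ napAlg V 𝔄) :
    (W V).adjoint ∘L T ∘L W V ∈ napAlg V 𝔄 := by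
  let f : (L2 V →L[ℂ] L2 V) →L[ℂ] (L2 V →L[ℂ] L2 V) :=
    (ContinuousLinearMap.compL ℂ (L2 V) (L2 V) (L2 V) (W V).adjoint) ∘L
      (ContinuousLinearMap.compL ℂ (L2 V) (L2 V) (L2 V)).flip (W V)
  refine napAlg_le V (S := (napAlg V 𝔄).comap f.toLinearMap)
    ((isClosed_napAlg V).preimage f.continuous) ?_ hT
  intro k a α β
  change (W V).adjoint ∘L Nap V k a α β ∘L W V ∈ napAlg V 𝔄
  have h : (W V).adjoint ∘L Nap V k a α β ∘L W V = Nap V (k + 1) a α β := by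
    rw [Nap_eq, Nap_eq, ← add_assoc, ← add_assoc, ← proj_comp_W, ← proj_comp_W,
      ContinuousLinearMap.adjoint_comp]
    rfl
  rw [h]
  exact Nap_mem V 𝔄 _ _ _ _

lemma star_mem_opSystem {X : Hhat V →L[ℂ] Hhat V} (hX : X ∈ opSystem V 𝔄) :
    star X ∈ opSystem V 𝔄 := by
  obtain ⟨a, α, β, T, hα, hβ, hT, rfl⟩ := hX
  refine ⟨star a, β, α, T.adjoint, hβ, hα, adjoint_mem_napAlg V hT, ?_⟩
  rw [star_block, ContinuousLinearMap.adjoint_adjoint]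
  rfl

lemma block_mem_opSystemAlg (a : 𝔄) {α β : Str 𝔄} {T : L2 V →L[ℂ] L2 V} (hα : 1 ≤ weight α)
    (hβ : 1 ≤ weight β) (hT : T ∈ napAlg V 𝔄) :
    block V (a : H →L[ℂ] H) (Gam V α) (Gam V β).adjoint T ∈ opSystemAlg V 𝔄 :=
  StarSubalgebra.le_topologicalClosure _
    (StarAlgebra.subset_adjoin ℂ _ ⟨a, α, β, T, hα, hβ, hT, rfl⟩)

lemma isClosed_opSystemAlg :
    IsClosed (opSystemAlg V 𝔄 : Set (Hhat V →L[ℂ] Hhat V)) :=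
  StarSubalgebra.isClosed_topologicalClosure _

lemma corner_mem_opSystemAlg {a : H →L[ℂ] H} (ha : a ∈ 𝔄) :
    Z V ∘L a ∘L (Z V).adjoint ∈ opSystemAlg V 𝔄 := by
  -- Strings of weight zero are not admitted in `𝒮`, so the zero gamma operator is realised with the
  -- coefficient `0` and weight one.
  have h : Gam V ([(1, 0)] : Str 𝔄) = 0 := by simp [Gam_eq, bra]
  have := block_mem_opSystemAlg V (⟨a, ha⟩ : 𝔄) (α := [(1, 0)]) (β := [(1, 0)]) (by simp)
    (by simp) (zero_mem (napAlg V 𝔄))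
  rwa [h, map_zero, ← block_corner] at this

lemma star_op_comp_Gam_comp_W (α : Str 𝔄) (hα : 1 ≤ weight α) :
    star (op V) ∘L Gam V α ∘L W V = Gam V (α ++ [(1, 1)]) := by
  have h : weight (α ++ [((1 : ℕ), (1 : 𝔄))]) - 1 = weight α - 1 + 1 := by simp; omega
  rw [Gam_eq, Gam_eq, h, bra_append, ← proj_comp_W]
  simp [bra]
  rfl

lemma star_op_comp_F_comp_proj (a : 𝔄) :
    star (op V) ∘L (a : H →L[ℂ] H) ∘L proj V 0 = Gam V [(1, a)] := by
  simp [Gam_eq, bra]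
  rfl

lemma adjoint_proj_comp_Gam_comp_W (α : Str 𝔄) (hα : 1 ≤ weight α) :
    (proj V 0).adjoint ∘L Gam V α ∘L W V = Nap V 0 1 [] α := by
  have h : weight α + 0 = weight α - 1 + 1 := by omega
  rw [Gam_eq, Nap_eq, h, ← proj_comp_W]
  simp [ket]
  rfl

/-- The result is kept as a sum of two matrices because an element of `𝒮` has a single gamma
operator in each off-diagonal corner, and the new one from `a` cannot be merged with the old one
from `b` or `c`. -/
lemma conj_Vhat_block (a : H →L[ℂ] H) (b c : L2 V →L[ℂ] H) (T : L2 V →L[ℂ] L2 V) :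
    star (Vhat V) * block V a b c.adjoint T * Vhat V =
      block V (star (op V) * a * op V)
          (star (op V) ∘L a ∘L proj V 0) (star (op V) ∘L star a ∘L proj V 0).adjoint
          ((proj V 0).adjoint ∘L a ∘L proj V 0) +
        block V 0 (star (op V) ∘L b ∘L W V) (star (op V) ∘L c ∘L W V).adjoint
          ((proj V 0).adjoint ∘L b ∘L W V + ((proj V 0).adjoint ∘L c ∘L W V).adjoint +
            (W V).adjoint ∘L T ∘L W V) := by
  rw [star_Vhat, Vhat, F_comp_proj, adjoint_proj_comp_F, block_mul_block, block_mul_block,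
    block_add_block]
  simp only [ContinuousLinearMap.adjoint_comp, ContinuousLinearMap.adjoint_adjoint,
    ContinuousLinearMap.star_eq_adjoint, ContinuousLinearMap.mul_def, ContinuousLinearMap.add_comp,
    ContinuousLinearMap.comp_assoc, ContinuousLinearMap.zero_comp,
    ContinuousLinearMap.comp_zero, add_zero]
  congr 1
  abel

/-- Conjugation by the unitary `V̂` is a continuous homomorphism, so only the matrices in `𝒮` need
to be examined. -/
lemma conj_Vhat_mem_opSystemAlg (h𝔄 : ∀ a ∈ 𝔄, star (op V) * a * op V ∈ 𝔄)
    {X : Hhat V →L[ℂ] Hhat V} (hX : X ∈ opSystemAlg V 𝔄) :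
    star (Vhat V) * X * Vhat V ∈ opSystemAlg V 𝔄 := by
  have hc : ∀ Y : Hhat V →L[ℂ] Hhat V, Y ∈ StarAlgebra.adjoin ℂ (opSystem V 𝔄) →
      star (Vhat V) * Y * Vhat V ∈ opSystemAlg V 𝔄 := by
    intro Y hY
    induction hY using StarAlgebra.adjoin_induction with
    | mem Y hY =>
      obtain ⟨a, α, β, T, hα, hβ, hT, rfl⟩ := hY
      rw [conj_Vhat_block, star_op_comp_Gam_comp_W V α hα, star_op_comp_Gam_comp_W V β hβ,
        star_op_comp_F_comp_proj, adjoint_proj_comp_Gam_comp_W V α hα,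
        adjoint_proj_comp_Gam_comp_W V β hβ]
      have h1 : star (a : H →L[ℂ] H) = ((star a : 𝔄) : H →L[ℂ] H) := rfl
      rw [h1, star_op_comp_F_comp_proj]
      have h2 : (proj V 0).adjoint ∘L (a : H →L[ℂ] H) ∘L proj V 0 = Nap V 0 a [] [] := by
        simp [Nap_eq, ket, bra]
      rw [h2]
      refine add_mem (block_mem_opSystemAlg V ⟨_, h𝔄 a a.2⟩ (by simp) (by simp)
        (Nap_mem V 𝔄 _ _ _ _)) ?_
      refine block_mem_opSystemAlg V (0 : 𝔄) (by simp) (by simp) ?_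
      exact add_mem (add_mem (Nap_mem V 𝔄 _ _ _ _)
        (adjoint_mem_napAlg V (Nap_mem V 𝔄 _ _ _ _))) (conj_W_mem_napAlg V hT)
    | algebraMap r =>
      rw [Algebra.algebraMap_eq_smul_one, mul_smul_comm, mul_one, smul_mul_assoc,
        star_Vhat_mul_Vhat, ← Algebra.algebraMap_eq_smul_one]
      exact algebraMap_mem _ r
    | add X Y _ _ hX hY => rw [mul_add, add_mul]; exact add_mem hX hY
    | mul X Y _ _ hX hY =>
      have h : star (Vhat V) * (X * Y) * Vhat V =
          (star (Vhat V) * X * Vhat V) * (star (Vhat V) * Y * Vhat V) := by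
        calc _ = star (Vhat V) * X * 1 * Y * Vhat V := by simp only [mul_assoc, mul_one]
          _ = _ := by rw [← Vhat_mul_star_Vhat]; simp only [mul_assoc]
      rw [h]; exact mul_mem hX hY
    | star X _ hX => simpa [mul_assoc] using star_mem hX
  have hcont : Continuous fun Y : Hhat V →L[ℂ] Hhat V => star (Vhat V) * Y * Vhat V := by fun_prop
  exact closure_minimal (s := (StarAlgebra.adjoin ℂ (opSystem V 𝔄) : Set (Hhat V →L[ℂ] Hhat V)))
    (t := {Y | star (Vhat V) * Y * Vhat V ∈ opSystemAlg V 𝔄}) hc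
    ((isClosed_opSystemAlg V).preimage hcont) hX

/-- `C*(𝒮)` itself belongs to the family whose intersection is the dilation algebra. -/
lemma dilationAlg_le_opSystemAlg (h𝔄 : ∀ a ∈ 𝔄, star (op V) * a * op V ∈ 𝔄) :
    dilationAlg V 𝔄 ≤ opSystemAlg V 𝔄 :=
  sInf_le ⟨isClosed_opSystemAlg V, le_rfl, fun _ => corner_mem_opSystemAlg V,
    fun _ => conj_Vhat_mem_opSystemAlg V h𝔄⟩

lemma conj_Vhat_pow_mem_opSystemAlg (h𝔄 : ∀ a ∈ 𝔄, star (op V) * a * op V ∈ 𝔄) (k : ℕ)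
    {X : Hhat V →L[ℂ] Hhat V} (hX : X ∈ opSystemAlg V 𝔄) :
    star (Vhat V) ^ k * X * Vhat V ^ k ∈ opSystemAlg V 𝔄 := by
  induction k with
  | zero => simpa using hX
  | succ k ih =>
    rw [pow_succ', pow_succ]
    simpa only [mul_assoc] using conj_Vhat_mem_opSystemAlg V h𝔄 ih

end Strings

/-! ### An invariant space of columns -/

section Columns

variable {H : Type*} [NormedAddCommGroup H] [InnerProductSpace ℂ H] [CompleteSpace H]
variable (V : H →ₗᵢ[ℂ] H) (𝔄 : StarSubalgebra ℂ (H →L[ℂ] H))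

/-- The closed linear span of the columns `(A, 0)` with `A ∈ 𝔄` and `(0, Γ*)` with gamma
operators `Γ`, as operators from `H` to `Ĥ`. -/
def columns : Submodule ℂ (H →L[ℂ] Hhat V) :=
  (Submodule.span ℂ ({P | ∃ a ∈ 𝔄, P = Z V ∘L a} ∪
    {P | ∃ α : Str 𝔄, 1 ≤ weight α ∧
      P = J V ∘L (proj V (weight α - 1)).adjoint ∘L ket V α})).topologicalClosure

lemma isClosed_columns : IsClosed (columns V 𝔄 : Set (H →L[ℂ] Hhat V)) :=
  Submodule.isClosed_topologicalClosure _

variable {𝔄}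

lemma Z_comp_mem_columns {a : H →L[ℂ] H} (ha : a ∈ 𝔄) : Z V ∘L a ∈ columns V 𝔄 :=
  Submodule.le_topologicalClosure _ (Submodule.subset_span (Or.inl ⟨a, ha, rfl⟩))

variable (𝔄) in
lemma Z_mem_columns : Z V ∈ columns V 𝔄 := Z_comp_mem_columns V (one_mem 𝔄)

lemma J_comp_mem_columns {α : Str 𝔄} {j : ℕ} (hα : weight α = j + 1) :
    J V ∘L (proj V j).adjoint ∘L ket V α ∈ columns V 𝔄 := by
  refine Submodule.le_topologicalClosure _ (Submodule.subset_span (Or.inr ⟨α, by omega, ?_⟩))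
  rw [hα]; rfl

lemma columns_le {S : Submodule ℂ (H →L[ℂ] Hhat V)}
    (hS : IsClosed (S : Set (H →L[ℂ] Hhat V))) (hZ : ∀ a ∈ 𝔄, Z V ∘L a ∈ S)
    (hJ : ∀ (α : Str 𝔄) (j : ℕ), weight α = j + 1 →
      J V ∘L (proj V j).adjoint ∘L ket V α ∈ S) : columns V 𝔄 ≤ S := by
  refine Submodule.topologicalClosure_minimal _ (Submodule.span_le.2 ?_) hS
  rintro _ (⟨a, ha, rfl⟩ | ⟨α, hα, rfl⟩)
  · exact hZ a ha
  · exact hJ α _ (by omega)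

lemma adjoint_Z_comp_mem (hcl : IsClosed (𝔄 : Set (H →L[ℂ] H))) {P : H →L[ℂ] Hhat V}
    (hP : P ∈ columns V 𝔄) : (Z V).adjoint ∘L P ∈ 𝔄 := by
  let f := ContinuousLinearMap.compL ℂ H (Hhat V) H (Z V).adjoint
  refine columns_le V (S := (Subalgebra.toSubmodule 𝔄.toSubalgebra).comap f.toLinearMap)
    (hcl.preimage f.continuous) (fun a ha => ?_) (fun α j _ => ?_) hP
  · change (Z V).adjoint ∘L Z V ∘L a ∈ 𝔄
    rw [← ContinuousLinearMap.comp_assoc, adjoint_Z_comp_Z]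
    exact ha
  · change (Z V).adjoint ∘L J V ∘L (proj V j).adjoint ∘L ket V α ∈ 𝔄
    rw [← ContinuousLinearMap.comp_assoc, adjoint_Z_comp_J, ContinuousLinearMap.zero_comp]
    exact zero_mem 𝔄

lemma J_comp_comp_mem_columns (h𝔄 : ∀ a ∈ 𝔄, star (op V) * a * op V ∈ 𝔄) {γ : Str 𝔄} {j : ℕ}
    (hγ : weight γ = j + 1) {T : L2 V →L[ℂ] L2 V} (hT : T ∈ napAlg V 𝔄) :
    J V ∘L T ∘L (proj V j).adjoint ∘L ket V γ ∈ columns V 𝔄 := by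
  let f : (L2 V →L[ℂ] L2 V) →L[ℂ] (H →L[ℂ] Hhat V) :=
    (ContinuousLinearMap.compL ℂ H (L2 V) (Hhat V) (J V)) ∘L
      (ContinuousLinearMap.compL ℂ H (L2 V) (L2 V)).flip ((proj V j).adjoint ∘L ket V γ)
  refine napAlg_le V (S := (columns V 𝔄).comap f.toLinearMap)
    ((isClosed_columns V 𝔄).preimage f.continuous) ?_ hT
  intro k a α β
  change J V ∘L Nap V k a α β ∘L (proj V j).adjoint ∘L ket V γ ∈ columns V 𝔄
  have h : J V ∘L Nap V k a α β ∘L (proj V j).adjoint ∘L ket V γ =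
      J V ∘L (proj V (weight α + k)).adjoint ∘L (ket V α * (a : H →L[ℂ] H) * bra V β) ∘L
        (proj V (weight β + k) ∘L (proj V j).adjoint) ∘L ket V γ := by
    rw [Nap_eq]; rfl
  rw [h, proj_comp_adjoint_proj]
  split_ifs with hj
  · subst hj
    -- Here `weight γ = weight β + k + 1`, so cancelling `(β|` leaves weight `k + 1`. The new ket
    -- has weight `weight α + k + 1`, one more than the index of its projection, as a generator of
    -- `columns` requires.
    obtain ⟨γ', h1, h2⟩ := F_mul_ket h𝔄 γ (by omega)
    obtain ⟨δ, h3, h4⟩ := bra_mul_ket h𝔄 β γ (by omega)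
    obtain ⟨δ', h5, h6⟩ := bra_mul_ket h𝔄 β γ' (by omega)
    have h7 : (ket V α * (a : H →L[ℂ] H) * bra V β) ∘L F V ∘L ket V γ =
        ket V (α ++ (0, a) :: δ) - ket V (α ++ (0, a) :: δ') := by
      change ket V α * (a : H →L[ℂ] H) * bra V β * (F V * ket V γ) = _
      rw [h1, mul_sub, mul_assoc _ (bra V β), mul_assoc _ (bra V β), h3, h5, ket_append,
        ket_append, ket_zero_cons, ket_zero_cons, mul_assoc, mul_assoc]
    rw [h7, ContinuousLinearMap.comp_sub, ContinuousLinearMap.comp_sub]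
    exact sub_mem (J_comp_mem_columns V (by simp; omega)) (J_comp_mem_columns V (by simp; omega))
  · simp

lemma Gam_comp_mem (h𝔄 : ∀ a ∈ 𝔄, star (op V) * a * op V ∈ 𝔄) {α γ : Str 𝔄} {j : ℕ}
    (hα : 1 ≤ weight α) (hγ : weight γ = j + 1) :
    Gam V α ∘L (proj V j).adjoint ∘L ket V γ ∈ 𝔄 := by
  have h : Gam V α ∘L (proj V j).adjoint ∘L ket V γ =
      bra V α ∘L (proj V (weight α - 1) ∘L (proj V j).adjoint) ∘L ket V γ := by
    rw [Gam_eq]; rfl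
  rw [h, proj_comp_adjoint_proj]
  split_ifs with hj
  · obtain ⟨γ', h1, h2⟩ := F_mul_ket h𝔄 γ (by omega)
    obtain ⟨δ, h3, h4⟩ := bra_mul_ket h𝔄 α γ (by omega)
    obtain ⟨δ', h5, h6⟩ := bra_mul_ket h𝔄 α γ' (by omega)
    change bra V α * (F V * ket V γ) ∈ 𝔄
    rw [h1, mul_sub, h3, h5]
    exact sub_mem (ket_mem δ (by omega)) (ket_mem δ' (by omega))
  · simp

lemma opSystem_comp_mem_columns (h𝔄 : ∀ a ∈ 𝔄, star (op V) * a * op V ∈ 𝔄)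
    {X : Hhat V →L[ℂ] Hhat V} (hX : X ∈ opSystem V 𝔄) {P : H →L[ℂ] Hhat V}
    (hP : P ∈ columns V 𝔄) : X ∘L P ∈ columns V 𝔄 := by
  obtain ⟨a, α, β, T, hα, hβ, hT, rfl⟩ := hX
  let f := ContinuousLinearMap.compL ℂ H (Hhat V) (Hhat V)
    (block V (a : H →L[ℂ] H) (Gam V α) (Gam V β).adjoint T)
  refine columns_le V (S := (columns V 𝔄).comap f.toLinearMap)
    ((isClosed_columns V 𝔄).preimage f.continuous) (fun c hc => ?_) (fun γ j hγ => ?_) hP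
  · change _ ∘L Z V ∘L c ∈ columns V 𝔄
    rw [← ContinuousLinearMap.comp_assoc, block_comp_Z, ContinuousLinearMap.add_comp]
    refine add_mem (Z_comp_mem_columns V (mul_mem a.2 hc)) ?_
    have h : (J V ∘L (Gam V β).adjoint) ∘L c = J V ∘L (proj V (weight β - 1)).adjoint ∘L
        ket V (starStr β ++ [(0, ⟨c, hc⟩)]) := by
      rw [adjoint_Gam, ket_append]
      simp [ket]
      rfl
    rw [h]
    exact J_comp_mem_columns V (by simp; omega)
  · change _ ∘L J V ∘L (proj V j).adjoint ∘L ket V γ ∈ columns V 𝔄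
    rw [← ContinuousLinearMap.comp_assoc, block_comp_J, ContinuousLinearMap.add_comp]
    exact add_mem (Z_comp_mem_columns V (Gam_comp_mem V h𝔄 hα hγ))
      (J_comp_comp_mem_columns V h𝔄 hγ hT)

lemma comp_mem_columns (h𝔄 : ∀ a ∈ 𝔄, star (op V) * a * op V ∈ 𝔄)
    {X : Hhat V →L[ℂ] Hhat V} (hX : X ∈ opSystemAlg V 𝔄) {P : H →L[ℂ] Hhat V}
    (hP : P ∈ columns V 𝔄) : X ∘L P ∈ columns V 𝔄 := by
  -- Treating `Y` and `star Y` together makes the star case a swap; quantifying over `P` is what the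
  -- product case needs.
  have hc : ∀ Y : Hhat V →L[ℂ] Hhat V, Y ∈ StarAlgebra.adjoin ℂ (opSystem V 𝔄) →
      ∀ P ∈ columns V 𝔄, Y ∘L P ∈ columns V 𝔄 ∧ star Y ∘L P ∈ columns V 𝔄 := by
    intro Y hY
    induction hY using StarAlgebra.adjoin_induction with
    | mem Y hY =>
      exact fun P hP => ⟨opSystem_comp_mem_columns V h𝔄 hY hP,
        opSystem_comp_mem_columns V h𝔄 (star_mem_opSystem V hY) hP⟩
    | algebraMap r =>
      intro P hP
      rw [← algebraMap_star_comm, Algebra.algebraMap_eq_smul_one, Algebra.algebraMap_eq_smul_one]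
      exact ⟨Submodule.smul_mem _ r hP, Submodule.smul_mem _ (star r) hP⟩
    | add X Y _ _ hX hY =>
      intro P hP
      have h : star (X + Y) = star X + star Y := star_add X Y
      rw [h, ContinuousLinearMap.add_comp, ContinuousLinearMap.add_comp]
      exact ⟨add_mem (hX P hP).1 (hY P hP).1, add_mem (hX P hP).2 (hY P hP).2⟩
    | mul X Y _ _ hX hY =>
      intro P hP
      rw [star_mul]
      exact ⟨(hX _ (hY P hP).1).1, (hY _ (hX P hP).2).2⟩
    | star X _ hX =>
      intro P hP
      rw [star_star]
      exact (hX P hP).symm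
  have hcont : Continuous fun Y : Hhat V →L[ℂ] Hhat V => Y ∘L P := by fun_prop
  exact closure_minimal (s := (StarAlgebra.adjoin ℂ (opSystem V 𝔄) : Set (Hhat V →L[ℂ] Hhat V)))
    (t := {Y | Y ∘L P ∈ columns V 𝔄}) (fun Y hY => (hc Y hY P hP).1)
    ((isClosed_columns V 𝔄).preimage hcont) hX

lemma compress_mem (h𝔄 : ∀ a ∈ 𝔄, star (op V) * a * op V ∈ 𝔄)
    (hcl : IsClosed (𝔄 : Set (H →L[ℂ] H))) {X : Hhat V →L[ℂ] Hhat V}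
    (hX : X ∈ opSystemAlg V 𝔄) : compress V X ∈ 𝔄 :=
  adjoint_Z_comp_mem V hcl (comp_mem_columns V h𝔄 hX (Z_mem_columns V 𝔄))

end Columns

end Nagy

/-! ### Cesàro means and null sequences -/

section Cesaro

variable {𝕜 : Type*} [RCLike 𝕜]

/-- The Cesàro mean of the first `N + 1` terms of a sequence. -/
def cesaroMean (s : ℕ → 𝕜) (N : ℕ) : 𝕜 := (1 / ((N : 𝕜) + 1)) * ∑ k ∈ Finset.range (N + 1), s k

lemma cesaroMean_add (s t : ℕ → 𝕜) : cesaroMean (s + t) = cesaroMean s + cesaroMean t := by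
  funext N; simp [cesaroMean, Finset.sum_add_distrib, mul_add]

lemma cesaroMean_smul (c : 𝕜) (s : ℕ → 𝕜) : cesaroMean (c • s) = c • cesaroMean s := by
  funext N; simp [cesaroMean, ← Finset.mul_sum, mul_left_comm]

lemma norm_cesaroMean_le (s : ℕ → 𝕜) (N : ℕ) :
    ‖cesaroMean s N‖ ≤ cesaroMean (fun k => ‖s k‖) N := by
  have h : ‖(1 / ((N : 𝕜) + 1))‖ = 1 / ((N : ℝ) + 1) := by
    have : ((N : 𝕜) + 1) = ((N + 1 : ℕ) : 𝕜) := by push_cast; rfl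
    rw [norm_div, norm_one, this, RCLike.norm_natCast]; push_cast; rfl
  rw [cesaroMean, norm_mul, h]
  exact mul_le_mul_of_nonneg_left (norm_sum_le _ _) (by positivity)

lemma cesaroMean_mono {s t : ℕ → ℝ} (h : ∀ k, s k ≤ t k) (N : ℕ) :
    cesaroMean s N ≤ cesaroMean t N :=
  mul_le_mul_of_nonneg_left (Finset.sum_le_sum fun k _ => h k) (by positivity)

lemma cesaroMean_nonneg {s : ℕ → ℝ} (h : ∀ k, 0 ≤ s k) (N : ℕ) : 0 ≤ cesaroMean s N :=
  mul_nonneg (by positivity) (Finset.sum_nonneg fun k _ => h k)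

lemma cesaroMean_const (c : 𝕜) (N : ℕ) : cesaroMean (fun _ => c) N = c := by
  have : ((N : 𝕜) + 1) ≠ 0 := by exact_mod_cast Nat.succ_ne_zero N
  simp [cesaroMean, this]

/-- Prepending a term does not affect the convergence of the Cesàro means to `0`. -/
lemma tendsto_cesaroMean_of_tail {s : ℕ → 𝕜}
    (h : Tendsto (cesaroMean fun k => s (k + 1)) atTop (𝓝 0)) :
    Tendsto (cesaroMean s) atTop (𝓝 0) := by
  rw [← tendsto_add_atTop_iff_nat 1]
  have h0 : Tendsto (fun N : ℕ => (1 : 𝕜) / ((N : 𝕜) + 1)) atTop (𝓝 0) :=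
    tendsto_one_div_add_atTop_nhds_zero_nat (𝕜 := 𝕜)
  have h1 : Tendsto (fun N : ℕ => (1 : 𝕜) / (((N + 1 : ℕ) : 𝕜) + 1)) atTop (𝓝 0) :=
    h0.comp (tendsto_add_atTop_nat 1)
  -- The mean of the first `N + 2` terms is a convex combination of `s 0`, with weight `1 / (N +
  -- 2)`, and the mean of `N + 1` terms of the tail.
  have h2 : Tendsto (fun N : ℕ => (1 - 1 / (((N + 1 : ℕ) : 𝕜) + 1)) *
      cesaroMean (fun k => s (k + 1)) N + 1 / (((N + 1 : ℕ) : 𝕜) + 1) * s 0) atTop (𝓝 0) := by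
    simpa using ((tendsto_const_nhds.sub h1).mul h).add (h1.mul_const (s 0))
  refine h2.congr fun N => ?_
  have n1 : ((N : 𝕜) + 1) ≠ 0 := by exact_mod_cast Nat.succ_ne_zero N
  have n2 : ((N : 𝕜) + 1 + 1) ≠ 0 := by exact_mod_cast Nat.succ_ne_zero (N + 1)
  rw [cesaroMean, cesaroMean, Finset.sum_range_succ' _ (N + 1)]
  push_cast
  field_simp
  ring

/-- Averaging does not increase the supremum norm, so a uniform error `ε` stays an error `ε` in
every mean. -/
lemma tendsto_cesaroMean_of_approx {s : ℕ → 𝕜}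
    (h : ∀ ε > 0, ∃ t : ℕ → 𝕜, Tendsto (cesaroMean t) atTop (𝓝 0) ∧ ∀ k, ‖s k - t k‖ ≤ ε) :
    Tendsto (cesaroMean s) atTop (𝓝 0) := by
  rw [Metric.tendsto_atTop]
  intro ε hε
  obtain ⟨t, ht, hst⟩ := h (ε / 2) (by positivity)
  obtain ⟨N, hN⟩ := Metric.tendsto_atTop.1 ht (ε / 2) (by positivity)
  refine ⟨N, fun n hn => ?_⟩
  have h1 := hN n hn
  rw [dist_zero_right] at h1 ⊢
  have h2 : cesaroMean s n = cesaroMean t n + cesaroMean (s - t) n := by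
    rw [← Pi.add_apply, ← cesaroMean_add, add_sub_cancel]
  have h3 : ‖cesaroMean (s - t) n‖ ≤ ε / 2 :=
    (norm_cesaroMean_le _ n).trans ((cesaroMean_mono hst n).trans_eq (cesaroMean_const _ n))
  rw [h2]
  linarith [norm_add_le (cesaroMean t n) (cesaroMean (s - t) n)]

variable (𝕜) in
/-- The sequences whose Cesàro means tend to `0`. -/
def cesaroNull : Submodule 𝕜 (ℕ → 𝕜) where
  carrier := {s | Tendsto (cesaroMean s) atTop (𝓝 0)}
  zero_mem' := by
    have : cesaroMean (0 : ℕ → 𝕜) = fun _ => 0 := funext fun N => cesaroMean_const 0 N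
    rw [Set.mem_ofPred_eq, this]
    exact tendsto_const_nhds
  add_mem' {s t} hs ht := by
    rw [Set.mem_ofPred_eq, cesaroMean_add]
    have h := Tendsto.add hs ht
    rwa [add_zero] at h
  smul_mem' c s hs := by
    rw [Set.mem_ofPred_eq, cesaroMean_smul]
    have h := Tendsto.const_smul hs c
    rwa [smul_zero] at h

variable (𝕜) in
/-- The sequences whose absolute values have Cesàro means that tend to `0`. -/
def absCesaroNull : Submodule 𝕜 (ℕ → 𝕜) where
  carrier := {s | Tendsto (cesaroMean fun k => ‖s k‖) atTop (𝓝 0)}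
  zero_mem' := by
    have : (cesaroMean fun k => ‖(0 : ℕ → 𝕜) k‖) = fun _ => 0 :=
      funext fun N => by simp [cesaroMean]
    rw [Set.mem_ofPred_eq, this]
    exact tendsto_const_nhds
  add_mem' {s t} hs ht := by
    have h : Tendsto (cesaroMean ((fun k => ‖s k‖) + fun k => ‖t k‖)) atTop (𝓝 0) := by
      rw [cesaroMean_add]
      have h := Tendsto.add hs ht
      rwa [add_zero] at h
    exact squeeze_zero (cesaroMean_nonneg fun k => norm_nonneg _)
      (cesaroMean_mono fun k => norm_add_le _ _) h
  smul_mem' c s hs := by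
    have h : (fun k => ‖(c • s) k‖) = ‖c‖ • fun k => ‖s k‖ := funext fun k => norm_smul c (s k)
    rw [Set.mem_ofPred_eq, h, cesaroMean_smul]
    have h := Tendsto.const_smul hs ‖c‖
    rwa [smul_zero] at h

/-- A space of sequences that is closed under uniform limits and contains a sequence as soon as it
contains its tail. -/
structure IsNullSpace (N : Submodule 𝕜 (ℕ → 𝕜)) : Prop where
  of_tail : ∀ {s : ℕ → 𝕜}, (fun k => s (k + 1)) ∈ N → s ∈ N
  of_approx : ∀ {s : ℕ → 𝕜}, (∀ ε > 0, ∃ t ∈ N, ∀ k, ‖s k - t k‖ ≤ ε) → s ∈ N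

lemma IsNullSpace.of_tail_add {N : Submodule 𝕜 (ℕ → 𝕜)} (hN : IsNullSpace N) (m : ℕ)
    {s : ℕ → 𝕜} (h : (fun k => s (k + m)) ∈ N) : s ∈ N := by
  induction m with
  | zero => exact h
  | succ m ih =>
    refine ih (hN.of_tail ?_)
    simpa only [add_assoc, add_comm 1 m] using h

variable (𝕜) in
lemma isNullSpace_cesaroNull : IsNullSpace (cesaroNull 𝕜) :=
  ⟨tendsto_cesaroMean_of_tail, tendsto_cesaroMean_of_approx⟩

variable (𝕜) in
lemma isNullSpace_absCesaroNull : IsNullSpace (absCesaroNull 𝕜) :=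
  ⟨fun {s} h => tendsto_cesaroMean_of_tail (s := fun k => ‖s k‖) h, fun {s} h =>
    tendsto_cesaroMean_of_approx fun ε hε => by
      obtain ⟨t, ht, hst⟩ := h ε hε
      exact ⟨fun k => ‖t k‖, ht, fun k => (abs_norm_sub_norm_le _ _).trans (hst k)⟩⟩

end Cesaro

/-- The norm of the powers of an isometry is at most one. -/
lemma norm_pow_le_one_of_star_mul_self {E : Type*} [NormedAddCommGroup E] [InnerProductSpace ℂ E]
    [CompleteSpace E] {T : E →L[ℂ] E} (hT : star T * T = 1) (k : ℕ) : ‖T ^ k‖ ≤ 1 := by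
  have h1 : ‖(1 : E →L[ℂ] E)‖ ≤ 1 := ContinuousLinearMap.norm_id_le
  have h : ‖T‖ ≤ 1 := by
    rw [← hT, CStarRing.norm_star_mul_self] at h1
    nlinarith [norm_nonneg T]
  induction k with
  | zero => simpa using h1
  | succ k ih =>
    rw [pow_succ]
    exact (norm_mul_le _ _).trans (mul_le_one₀ ih (norm_nonneg _) h)

/-- A continuous functional on a C*-algebra extends along a faithful representation. -/
lemma exists_functional_extension {A B : Type*} [CStarAlgebra A] [CStarAlgebra B]
    (π : A →⋆ₐ[ℂ] B) (hπ : Function.Injective π) (φ : A →L[ℂ] ℂ) :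
    ∃ ω : B →L[ℂ] ℂ, ∀ a, ω (π a) = φ a := by
  let i : A →ₗᵢ[ℂ] B :=
    { toLinearMap := π.toAlgHom.toLinearMap
      norm_map' := NonUnitalStarAlgHom.norm_map π hπ }
  obtain ⟨ω, hω, -⟩ := exists_extension_norm_eq (LinearMap.range i.toLinearMap)
    (φ ∘L i.equivRange.symm.toContinuousLinearEquiv.toContinuousLinearMap)
  refine ⟨ω, fun a => ?_⟩
  have h := hω (i.equivRange a)
  simp only [ContinuousLinearMap.comp_apply] at h
  exact h.trans (congrArg φ (i.equivRange.symm_apply_apply a))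

/-! ### Densities from the `φ`-adjoint -/

section Adjoint

variable {A : Type*} [CStarAlgebra A] [PartialOrder A] [StarOrderedRing A]
variable {Φ Ψ : A →CP A} {φ : A →ₚ[ℂ] ℂ}

lemma map_mul_iterate_of_adjoint (h : ∀ a b : A, φ (Φ a * b) = φ (a * Ψ b)) (n : ℕ) (a b : A) :
    φ (a * (⇑Φ)^[n] b) = φ ((⇑Ψ)^[n] a * b) := by
  -- Conjugating the adjoint relation, with `φ`, `Φ` and `Ψ` all preserving stars, moves `Φ` to the
  -- right factor.
  have h1 (a b : A) : φ (a * Φ b) = φ (Ψ a * b) := by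
    have := congrArg star (h (star b) (star a))
    simpa only [← map_star, star_mul, star_star] using this
  induction n generalizing a with
  | zero => rfl
  | succ n ih => rw [Function.iterate_succ_apply', h1, ih, Function.iterate_succ_apply]

end Adjoint

namespace CovariantRep

open Nagy

variable {A : Type*} [CStarAlgebra A] [PartialOrder A] [StarOrderedRing A]
variable {Φ Ψ : A →CP A} {φ : A →ₚ[ℂ] ℂ}
variable {H : Type*} [NormedAddCommGroup H] [InnerProductSpace ℂ H] [CompleteSpace H]
variable (R : CovariantRep Φ H)

lemma conj_mem_range : ∀ a ∈ R.π.range, star (op R.V) * a * op R.V ∈ R.π.range := by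
  rintro _ ⟨a, rfl⟩
  exact ⟨Φ a, (R.covariant a).symm⟩

lemma isClosed_range : IsClosed (R.π.range : Set (H →L[ℂ] H)) :=
  (NonUnitalStarAlgHom.isometry R.π R.faithful).isClosedEmbedding.isClosed_range

lemma conj_pow (n : ℕ) (a : A) :
    star (op R.V) ^ n * R.π a * op R.V ^ n = R.π ((⇑Φ)^[n] a) := by
  induction n generalizing a with
  | zero => simp
  | succ n ih =>
    rw [Function.iterate_succ_apply, ← ih, ← R.covariant, pow_succ, pow_succ']
    simp only [mul_assoc]

variable {R} in
-- The inner powers `V^{n*} · V^n` act on `a c` as `Φ^n`, and the adjoint moves `Φ^n` onto the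
-- density already found: the new density is `Ψ^n(d) a`.
lemma exists_bra_density (h : ∀ a b : A, φ (Φ a * b) = φ (a * Ψ b))
    {ω : (H →L[ℂ] H) →L[ℂ] ℂ} (hω : ∀ a, ω (R.π a) = φ a) (α : Str R.π.range) :
    ∃ d : A, ∀ c : A, ω (bra R.V α * R.π c * op R.V ^ weight α) = φ (d * c) := by
  induction α with
  | nil => exact ⟨1, fun c => by simp [bra, hω]⟩
  | cons p α ih =>
    obtain ⟨n, a⟩ := p
    obtain ⟨a', ha'⟩ := a.2
    change R.π a' = a at ha'
    obtain ⟨d, hd⟩ := ih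
    refine ⟨(⇑Ψ)^[n] d * a', fun c => ?_⟩
    rw [mul_assoc _ a' c, ← map_mul_iterate_of_adjoint h, ← hd, ← conj_pow, map_mul R.π, ha',
      weight_cons, pow_add, bra]
    simp only [mul_assoc]

/-! ### Correlations of columns -/

/-- The correlation of two columns, as a sequence of complex numbers. -/
def correlation (ω : (H →L[ℂ] H) →L[ℂ] ℂ) (P Q : H →L[ℂ] Hhat R.V) (z : ℂ) (k : ℕ) : ℂ :=
  ω (P.adjoint ∘L (star (Vhat R.V) ^ k) ∘L Q ∘L (op R.V ^ k)) - ω (P.adjoint ∘L Z R.V) * z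

variable {R} {ω : (H →L[ℂ] H) →L[ℂ] ℂ}

lemma correlation_add (P P' Q : H →L[ℂ] Hhat R.V) (z : ℂ) :
    R.correlation ω (P + P') Q z = R.correlation ω P Q z + R.correlation ω P' Q z := by
  funext k
  simp only [correlation, map_add, ContinuousLinearMap.add_comp, Pi.add_apply]
  ring

lemma correlation_smul (c : ℂ) (P Q : H →L[ℂ] Hhat R.V) (z : ℂ) :
    R.correlation ω (c • P) Q z = star c • R.correlation ω P Q z := by
  funext k
  simp only [correlation, map_smulₛₗ, ContinuousLinearMap.smul_comp, Pi.smul_apply, smul_eq_mul,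
    RingHom.id_apply]
  change starRingEnd ℂ c * _ - starRingEnd ℂ c * _ * z = starRingEnd ℂ c * _
  ring

/-- The powers of `V` and `V̂*` are contractions, so the bound does not depend on `k`; this turns
norm limits in `P` into uniform limits of sequences. -/
lemma norm_correlation_le (P Q : H →L[ℂ] Hhat R.V) (z : ℂ) (k : ℕ) :
    ‖R.correlation ω P Q z k‖ ≤ ‖ω‖ * (‖Q‖ + ‖Z R.V‖ * ‖z‖) * ‖P‖ := by
  have hV := norm_pow_le_one_of_star_mul_self (star_op_mul_op R.V) k
  have hW : ‖star (Vhat R.V) ^ k‖ ≤ 1 := norm_pow_le_one_of_star_mul_self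
    (by rw [star_star, Vhat_mul_star_Vhat]) k
  have hP : ‖P.adjoint‖ = ‖P‖ := LinearIsometryEquiv.norm_map _ P
  have h1 : ‖P.adjoint ∘L (star (Vhat R.V) ^ k) ∘L Q ∘L (op R.V ^ k)‖ ≤ ‖P‖ * ‖Q‖ := by
    calc _ ≤ ‖P.adjoint‖ * (‖star (Vhat R.V) ^ k‖ * (‖Q‖ * ‖op R.V ^ k‖)) := by
          refine (ContinuousLinearMap.opNorm_comp_le _ _).trans ?_
          gcongr
          refine (ContinuousLinearMap.opNorm_comp_le _ _).trans ?_
          gcongr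
          exact ContinuousLinearMap.opNorm_comp_le _ _
      _ ≤ ‖P‖ * (1 * (‖Q‖ * 1)) := by rw [hP]; gcongr
      _ = ‖P‖ * ‖Q‖ := by ring
  have h2 : ‖P.adjoint ∘L Z R.V‖ ≤ ‖P‖ * ‖Z R.V‖ := by
    rw [← hP]; exact ContinuousLinearMap.opNorm_comp_le _ _
  calc _ ≤ ‖ω‖ * (‖P‖ * ‖Q‖) + ‖ω‖ * (‖P‖ * ‖Z R.V‖) * ‖z‖ := by
        refine (norm_sub_le _ _).trans ?_
        rw [norm_mul]
        gcongr
        · exact ω.le_of_opNorm_le_of_le le_rfl h1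
        · exact ω.le_of_opNorm_le_of_le le_rfl h2
    _ = _ := by ring

lemma correlation_Z (hω : ∀ a, ω (R.π a) = φ a) {Q : H →L[ℂ] Hhat R.V} {a b : A}
    (hb : R.π b = (Z R.V).adjoint ∘L Q) (k : ℕ) :
    R.correlation ω (Z R.V ∘L R.π (star a)) Q (φ b) k =
      φ (a * (⇑Φ)^[k] b) - φ a * φ b := by
  have h0 : (Z R.V ∘L R.π (star a)).adjoint = R.π a ∘L (Z R.V).adjoint := by
    rw [ContinuousLinearMap.adjoint_comp, ← ContinuousLinearMap.star_eq_adjoint, ← map_star,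
      star_star]
  have h1 : (Z R.V).adjoint ∘L (star (Vhat R.V) ^ k) =
      (star (op R.V) ^ k) ∘L (Z R.V).adjoint := by
    have := congrArg ContinuousLinearMap.adjoint (Vhat_pow_comp_Z R.V k)
    rw [ContinuousLinearMap.adjoint_comp, ContinuousLinearMap.adjoint_comp] at this
    rw [← star_pow, ← star_pow]
    exact this
  have h2 : (Z R.V ∘L R.π (star a)).adjoint ∘L (star (Vhat R.V) ^ k) ∘L Q ∘L (op R.V ^ k) =
      R.π (a * (⇑Φ)^[k] b) := by
    rw [h0, map_mul, ← conj_pow, hb]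
    change R.π a ∘L ((Z R.V).adjoint ∘L (star (Vhat R.V) ^ k)) ∘L Q ∘L (op R.V ^ k) = _
    rw [h1]
    rfl
  have h3 : (Z R.V ∘L R.π (star a)).adjoint ∘L Z R.V = R.π a := by
    rw [h0, ContinuousLinearMap.comp_assoc, adjoint_Z_comp_Z]; rfl
  rw [correlation, h2, h3, hω, hω]

/-- The product term drops out since `J* Z = 0`. The shift by `weight α = j + 1` is the time the
column needs to reach `H`. -/
lemma correlation_J {Q : H →L[ℂ] Hhat R.V} {b : A} (hb : R.π b = (Z R.V).adjoint ∘L Q)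
    (α : Str R.π.range) {j : ℕ} (hα : weight α = j + 1) (z : ℂ) (l : ℕ) :
    R.correlation ω (J R.V ∘L (proj R.V j).adjoint ∘L ket R.V α) Q z (l + weight α) =
      ω (bra R.V (starStr α) * F R.V * R.π ((⇑Φ)^[l] b) * op R.V ^ weight α) := by
  have h0 : (J R.V ∘L (proj R.V j).adjoint ∘L ket R.V α).adjoint =
      (bra R.V (starStr α) ∘L proj R.V j) ∘L (J R.V).adjoint := by
    rw [ContinuousLinearMap.adjoint_comp, ContinuousLinearMap.adjoint_comp,
      ContinuousLinearMap.adjoint_adjoint, ← star_ket]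
    rfl
  have h1 : (proj R.V j ∘L (J R.V).adjoint) ∘L (star (Vhat R.V) ^ (l + (j + 1))) =
      F R.V ∘L (star (op R.V) ^ l) ∘L (Z R.V).adjoint := by
    have := congrArg ContinuousLinearMap.adjoint (Vhat_pow_add_comp_J R.V l j)
    simp only [ContinuousLinearMap.adjoint_comp, ContinuousLinearMap.adjoint_adjoint,
      adjoint_F] at this
    rw [← star_pow, ← star_pow]
    exact this
  have h2 : (J R.V ∘L (proj R.V j).adjoint ∘L ket R.V α).adjoint ∘L Z R.V = 0 := by
    rw [h0, ContinuousLinearMap.comp_assoc, adjoint_J_comp_Z, ContinuousLinearMap.comp_zero]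
  rw [correlation, h2, map_zero, zero_mul, sub_zero, h0, ← conj_pow, hb, hα]
  congr 1
  change bra R.V (starStr α) ∘L ((proj R.V j ∘L (J R.V).adjoint) ∘L
    (star (Vhat R.V) ^ (l + (j + 1)))) ∘L Q ∘L (op R.V ^ (l + (j + 1))) = _
  rw [h1, pow_add (op R.V)]
  rfl

/-- A gamma operator followed by the defect projection is a difference of two operators of
strings which agree after multiplication by the power of the isometry. -/
lemma exists_bra_mul_F (α : Str R.π.range) (hα : 1 ≤ weight α) :
    ∃ β : Str R.π.range, weight β = weight α ∧
      bra R.V α * F R.V = bra R.V α - bra R.V β ∧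
      bra R.V β * op R.V ^ weight α = bra R.V α * op R.V ^ weight α := by
  obtain ⟨β, h1, h2⟩ := F_mul_ket R.conj_mem_range (starStr α) (by simpa using hα)
  have h3 : bra R.V α * F R.V = bra R.V α - bra R.V (starStr β) := by
    have := congrArg star h1
    rwa [star_mul, star_sub, star_ket, star_ket, starStr_starStr, star_F] at this
  refine ⟨starStr β, by simpa using h2, h3, ?_⟩
  -- The two bras differ by `bra V α * F V`, which is killed by `F V = 0` as soon as one factor of
  -- the isometry follows.
  have h4 : bra R.V (starStr β) = bra R.V α - bra R.V α * F R.V := by rw [h3]; abel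
  obtain ⟨m, hm⟩ := Nat.exists_eq_add_of_le' hα
  rw [h4, sub_mul, hm, pow_succ', mul_assoc _ (F R.V), ← mul_assoc (F R.V), F_mul_op, zero_mul,
    mul_zero, sub_zero]

lemma correlation_mem (h : ∀ a b : A, φ (Φ a * b) = φ (a * Ψ b)) (hω : ∀ a, ω (R.π a) = φ a)
    {N : Submodule ℂ (ℕ → ℂ)} (hN : IsNullSpace N)
    (hmix : ∀ a b : A, (fun k => φ (a * (⇑Φ)^[k] b) - φ a * φ b) ∈ N)
    {P Q : H →L[ℂ] Hhat R.V} (hP : P ∈ columns R.V R.π.range) {b : A}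
    (hb : R.π b = (Z R.V).adjoint ∘L Q) : R.correlation ω P Q (φ b) ∈ N := by
  -- The correlation is conjugate linear in `P`, which still makes the good columns a linear
  -- subspace.
  let S : Submodule ℂ (H →L[ℂ] Hhat R.V) :=
    { carrier := {P | R.correlation ω P Q (φ b) ∈ N}
      zero_mem' := by
        have := correlation_smul (ω := ω) (0 : ℂ) (0 : H →L[ℂ] Hhat R.V) Q (φ b)
        rw [Set.mem_ofPred_eq, ← zero_smul ℂ (0 : H →L[ℂ] Hhat R.V), this, star_zero, zero_smul]
        exact zero_mem N
      add_mem' := fun hP hP' => by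
        rw [Set.mem_ofPred_eq, correlation_add]
        exact add_mem hP hP'
      smul_mem' := fun c P hP => by
        rw [Set.mem_ofPred_eq, correlation_smul]
        exact Submodule.smul_mem _ _ hP }
  refine columns_le R.V (S := S) ?_ ?_ ?_ hP
  · refine isClosed_of_closure_subset fun P hP => hN.of_approx fun ε hε => ?_
    set C := ‖ω‖ * (‖Q‖ + ‖Z R.V‖ * ‖φ b‖) with hC
    have hC0 : 0 ≤ C := by positivity
    -- The denominator `C + 1` instead of `C` guards against `C = 0`.
    obtain ⟨P', hP', hd⟩ := (SeminormedAddCommGroup.mem_closure_iff (E := H →L[ℂ] Hhat R.V)).1 hP (ε / (C + 1)) (by positivity)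
    refine ⟨_, hP', fun k => ?_⟩
    have h1 : R.correlation ω P Q (φ b) k - R.correlation ω P' Q (φ b) k =
        R.correlation ω (P - P') Q (φ b) k := by
      have := congrFun (correlation_add (ω := ω) (P - P') P' Q (φ b)) k
      rw [sub_add_cancel, Pi.add_apply] at this
      rw [this, add_sub_cancel_right]
    rw [h1]
    rw [lt_div_iff₀ (by positivity)] at hd
    refine (norm_correlation_le _ _ _ _).trans ?_
    rw [← hC]
    nlinarith [norm_nonneg (P - P')]
  · rintro _ ⟨a, rfl⟩
    have := hmix (star a) b
    change R.correlation ω (Z R.V ∘L R.π a) Q (φ b) ∈ N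
    rw [← star_star a]
    rwa [funext (correlation_Z hω hb)]
  · intro α j hα
    obtain ⟨β, h1, h2, h3⟩ := R.exists_bra_mul_F (starStr α) (by simp; omega)
    obtain ⟨d, hd⟩ := exists_bra_density h hω (starStr α)
    obtain ⟨e, he⟩ := exists_bra_density h hω β
    rw [h1] at he
    rw [weight_starStr] at hd he h3
    -- Taking `c = 1` in both densities: the two bras agree after multiplication by `V^{weight α}`.
    -- Hence the constants `φ d * φ b` and `φ e * φ b` cancel below.
    have hde : φ d = φ e := by
      have h4 := hd 1
      have h5 := he 1
      simp only [map_one, mul_one] at h4 h5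
      rw [← h4, ← h5, h3]
    refine hN.of_tail_add (weight α) ?_
    have h6 : (fun l => R.correlation ω (J R.V ∘L (proj R.V j).adjoint ∘L ket R.V α) Q (φ b)
        (l + weight α)) = (fun k => φ (d * (⇑Φ)^[k] b) - φ d * φ b) -
          fun k => φ (e * (⇑Φ)^[k] b) - φ e * φ b := by
      funext l
      rw [correlation_J hb α hα, h2, sub_mul, sub_mul, map_sub, hd, he, Pi.sub_apply, hde]
      ring
    rw [h6]
    exact sub_mem (hmix d b) (hmix e b)

end CovariantRep

/-! ### The mixing theorem for the dilation -/

theorem mainTheorem4 {A : Type*} [CStarAlgebra A] [PartialOrder A] [StarOrderedRing A]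
    (Φ : A →CP A) (hΦ : Φ 1 = 1)
    (φ : A →ₚ[ℂ] ℂ) (hφ : φ 1 = 1) (hinv : ∀ a : A, φ (Φ a) = φ a)
    (hadj : AdmitsAdjoint Φ φ)
    {H : Type*} [NormedAddCommGroup H] [InnerProductSpace ℂ H] [CompleteSpace H]
    (R : CovariantRep Φ H)
    (X Y : Nagy.Hhat R.V →L[ℂ] Nagy.Hhat R.V)
    (hX : X ∈ Nagy.dilationAlg R.V R.π.range) (hY : Y ∈ Nagy.dilationAlg R.V R.π.range) :
    ∃ (x y : A) (c : ℕ → A),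
      R.π x = Nagy.compress R.V X ∧ R.π y = Nagy.compress R.V Y ∧
      (∀ k : ℕ, R.π (c k) =
        Nagy.compress R.V (X * (star (Nagy.Vhat R.V) ^ k * Y * Nagy.Vhat R.V ^ k))) ∧
      (IsErgodicState Φ φ →
        Tendsto (fun N : ℕ => (1 / ((N : ℂ) + 1)) *
          ∑ k ∈ Finset.range (N + 1), (φ (c k) - φ x * φ y)) atTop (𝓝 0)) ∧
      (IsWeaklyMixingState Φ φ →
        Tendsto (fun N : ℕ => (1 / ((N : ℝ) + 1)) *
          ∑ k ∈ Finset.range (N + 1), ‖φ (c k) - φ x * φ y‖) atTop (𝓝 0)) := by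
  have h𝔄 := R.conj_mem_range
  have hX' := Nagy.dilationAlg_le_opSystemAlg R.V h𝔄 hX
  have hY' := Nagy.dilationAlg_le_opSystemAlg R.V h𝔄 hY
  obtain ⟨x, hx⟩ := Nagy.compress_mem R.V h𝔄 R.isClosed_range hX'
  obtain ⟨y, hy⟩ := Nagy.compress_mem R.V h𝔄 R.isClosed_range hY'
  have hk (k : ℕ) := Nagy.compress_mem R.V h𝔄 R.isClosed_range
    (mul_mem hX' (Nagy.conj_Vhat_pow_mem_opSystemAlg R.V h𝔄 k hY'))
  choose c hc using hk
  change R.π x = _ at hx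
  change R.π y = _ at hy
  change ∀ k, R.π (c k) = _ at hc
  obtain ⟨Ψ, -, hΨ⟩ := hadj
  -- A bounded extension of `φ` to all operators on `H` allows evaluating it on products before they
  -- are identified as elements of `𝔄`; positivity of the extension plays no role.
  obtain ⟨ω, hω⟩ := exists_functional_extension R.π R.faithful
    ⟨φ.toLinearMap, map_continuous φ⟩
  change ∀ a, ω (R.π a) = φ a at hω
  have hP := Nagy.comp_mem_columns R.V h𝔄 (star_mem hX') (Nagy.Z_mem_columns R.V R.π.range)
  have hPadj : (star X ∘L Nagy.Z R.V).adjoint = (Nagy.Z R.V).adjoint ∘L X := by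
    rw [ContinuousLinearMap.adjoint_comp, ← ContinuousLinearMap.star_eq_adjoint, star_star]
  -- The intertwining `V̂^k Z = Z V^k` rewrites the correlation of `X` and `Y` as that of the
  -- columns `X* Z` and `Y Z`.
  have hs : R.correlation ω (star X ∘L Nagy.Z R.V) (Y ∘L Nagy.Z R.V) (φ y) =
      fun k => φ (c k) - φ x * φ y := by
    funext k
    rw [CovariantRep.correlation, hPadj, ← hω (c k), ← hω x, hc, hx,
      ContinuousLinearMap.comp_assoc Y, ← Nagy.Vhat_pow_comp_Z]
    rfl
  have key : ∀ N : Submodule ℂ (ℕ → ℂ), IsNullSpace N →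
      (∀ a b : A, (fun k => φ (a * (⇑Φ)^[k] b) - φ a * φ b) ∈ N) →
      (fun k => φ (c k) - φ x * φ y) ∈ N := fun N hN hmix =>
    hs ▸ CovariantRep.correlation_mem hΨ hω hN hmix hP hy
  exact ⟨x, y, c, hx, hy, hc, key _ (isNullSpace_cesaroNull ℂ),
    key _ (isNullSpace_absCesaroNull ℂ)⟩

end
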